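/- **Setting.** Let $d\in\{2,3\}$. A triangulated cluster consists of finitely many oriented polyhedral surfaces $\Gamma_1,\dots,\Gamma_{I_S}$ in $\mathbb R^d$ (polygonal curves if $d=2$). Every $(d-2)$-face of a surface is either shared by exactly two of its simplices, which are consistently oriented, or lies in exactly one part of the boundary of the surface. At each triple junction line $\mathcal T_k$ boundary parts of three different surfaces $\Gamma_{s^k_1},\Gamma_{s^k_2},\Gamma_{s^k_3}$ are matched vertex by vertex, and $o^k_j\in\{\pm1\}$ are such that the pairs $(o^k_j\vec\nu_{s^k_j},\vec\mu_{s^k_j})$ of normal and outer conormal have the same orientation for $j=1,2,3$; different surfaces have vertices and faces in common only through this matching. Each boundary line $\mathcal B_k$ ($1\le k\le I_B$) is a boundary part of a surface $\Gamma_{s_k}$, used in no triple junction line, and is attached to an external planar surface $\mathcal D_k$ with unit normal $\vec n_k$. For an ordered $(d-1)$-simplex $\sigma$ with vertices $\vec q_0,\dots,\vec q_{d-1}$ let $\vec A\{\sigma\}=(\vec q_1-\vec q_0)\wedge\dots\wedge(\vec q_{d-1}-\vec q_0)$ be its orientation vector, so that $|\sigma|=|\vec A\{\sigma\}|/(d-1)!$,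 and $\vec\nu=\vec A\{\sigma\}/|\vec A\{\sigma\}|$ its unit normal. Let $\Gamma^m$ be such a cluster with nondegenerate simplices $\sigma^m_j$, with $\mathcal B_k^m$ contained in the plane of $\mathcal D_k$, and let $\Delta t_m=t_{m+1}-t_m>0$. All finite element functions are continuous and piecewise affine on each surface of $\Gamma^m$. $W^h$ consists of the scalar ones with $\sum_{j=1}^3o^k_j\chi_{s^k_j}=0$ on each $\mathcal T_k^m$; $V^h$ of the $\mathbb R^d$-valued ones with $\vec\eta_{s^k_1}=\vec\eta_{s^k_2}=\vec\eta_{s^k_3}$ on each $\mathcal T_k^m$; and $V^h_\partial$ of those $\vec\eta\in V^h$ with $\vec n_k\cdot\vec\eta_{s_k}=0$ on each $\mathcal B_k^m$. Let $\langle\cdot,\cdot\rangle$ be the $L^2$ inner product over $\Gamma^m$ and $\langle\cdot,\cdot\rangle^h$ its mass-lumped version (vertex quadrature on each simplex). For $\vec X^{m+1}\in V^h$ let $\Gamma^{m+1}=\vec X^{m+1}(\Gamma^m)$, and for $t\in[t_m,t_{m+1}]$ let $\Gamma^h(t)$, with simplices $\sigma^h_j(t)$, be the linear interpolation in time of the vertices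 of $\Gamma^m$ and $\Gamma^{m+1}$. On $\sigma^m_j$ let $$\vec\nu^{m+\frac12}=\frac1{\Delta t_m|\vec A\{\sigma^m_j\}|}\int_{t_m}^{t_{m+1}}\vec A\{\sigma^h_j(t)\}\,dt .$$ On $\mathcal B_k$ let $\vec\xi_k=(\vec n_k\cdot\vec\nu_{s_k})\vec\mu_{s_k}-(\vec n_k\cdot\vec\mu_{s_k})\vec\nu_{s_k}$. If $d=2$, then, up to length, $\vec\xi_k$ is the rotation of $\vec n_k$ by a right angle for which $(\vec n_k,\vec\xi_k)$ has the orientation of $(\vec\nu_{s_k},\vec\mu_{s_k})$, and $\vec\xi_k^{m+\frac12}$ is this rotation of $\vec n_k$. If $d=3$, let the segments $L$ of $\mathcal B_k$ be directed by $\vec\mu_{s_k}\times\vec\nu_{s_k}$, with edge vectors $\vec f\{L\}$; then, up to length, $\vec\xi_k=\vec n_k\times\vec f\{L\}$, and $$\vec\xi_k^{m+\frac12}\big|_{L^m}=\vec n_k\times\Big(\frac1{\Delta t_m|\vec f\{L^m\}|}\int_{t_m}^{t_{m+1}}\vec f\{L^h(t)\}\,dt\Big).$$ The anisotropy is $\gamma(\vec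 p)=\big(\sum_{\ell=1}^L\gamma_\ell(\vec p)^r\big)^{1/r}$ with $L\ge1$, $r\ge1$, $\gamma_\ell(\vec p)=\sqrt{\vec p\cdot G_\ell\vec p}$ and symmetric positive definite $G_\ell\in\mathbb R^{d\times d}$. Put $\widetilde G_\ell=(\det G_\ell)^{1/(d-1)}G_\ell^{-1}$, $(\vec x,\vec y)_{\widetilde G_\ell}=\vec x\cdot\widetilde G_\ell\vec y$ and, with $\vec t^{\,\ell}_1,\dots,\vec t^{\,\ell}_{d-1}$ a $\widetilde G_\ell$-orthonormal basis of the tangent plane of $\Gamma^m$, $$\langle\nabla_s^{\widetilde G}\vec\eta,\nabla_s^{\widetilde G}\vec\chi\rangle_{\gamma,\Gamma^m}=\sum_{i=1}^{I_S}\sum_{\ell=1}^L\int_{\Gamma_i^m}\Big[\frac{\gamma_\ell(\vec\nu_i^{m+1})}{\gamma(\vec\nu_i^{m+1})}\Big]^{r-1}\sum_{a=1}^{d-1}\big(\partial_{\vec t^{\,\ell}_a}\vec\eta_i,\partial_{\vec t^{\,\ell}_a}\vec\chi_i\big)_{\widetilde G_\ell}\,\gamma_\ell(\vec\nu_i^m)\,d\mathscr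 H^{d-1}.$$ **Scheme.** Let $\widehat{\varrho}_k^{\,\pm}\in\mathbb R$ and $\varrho_k=\widehat{\varrho}_k^{\,+}-\widehat{\varrho}_k^{\,-}$. Let $(\vec X^{m+1},\kappa_\gamma^{m+1})\in V^h\times W^h$ with $\vec X^{m+1}-\vec{\rm id}\in V^h_\partial$ satisfy $$\frac1{\Delta t_m}\langle\vec X^{m+1}-\vec{\rm id},\chi\,\vec\nu^{m+\frac12}\rangle^h-\langle\nabla_s\kappa_\gamma^{m+1},\nabla_s\chi\rangle=0\qquad\forall\chi\in W^h,$$ $$\langle\kappa_\gamma^{m+1}\vec\nu^{m+\frac12},\vec\eta\rangle^h+\langle\nabla_s^{\widetilde G}\vec X^{m+1},\nabla_s^{\widetilde G}\vec\eta\rangle_{\gamma,\Gamma^m}=\sum_{k=1}^{I_B}\varrho_k\int_{\mathcal B_k^m}\vec\xi_k^{m+\frac12}\cdot\vec\eta_{s_k}\,d\mathscr H^{d-2}\qquad\forall\vec\eta\in V^h_\partial.$$ **Theorem.** (i) Suppose that, for $\Gamma=\Gamma^m$ and for $\Gamma=\Gamma^{m+1}$, each $\mathcal B_k$ divides $\mathscr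 G_k=\mathcal D_k\cap\overline{B_R(0)}$ into two parts $\mathscr G_k^{\pm}$, where $\vec\xi_k$ is the outer normal to $\mathscr G_k^-$ on $\mathcal B_k$. The two divisions are to be labelled consistently: up to null sets, $\mathscr G_k^{m,-}$ and $\mathscr G_k^{m+1,-}$ consist of a common fixed set and of disjoint bounded polygonal regions (intervals if $d=2$), whose boundaries have the same combinatorial structure and consist of the boundary line $\mathcal B_k$ and of further points or segments, each of which stays in a fixed $(d-2)$-plane (for instance an edge of $\mathcal D_k$). Then, with $$E(\Gamma)=\sum_{i=1}^{I_S}\int_{\Gamma_i}\gamma(\vec\nu_i)\,d\mathscr H^{d-1}+\sum_{k=1}^{I_B}\big(\widehat{\varrho}_k^{\,+}|\mathscr G_k^+|+\widehat{\varrho}_k^{\,-}|\mathscr G_k^-|\big),$$ we have $$E(\Gamma^{m+1})+\Delta t_m\langle\nabla_s\kappa_\gamma^{m+1},\nabla_s\kappa_\gamma^{m+1}\rangle\le E(\Gamma^m).$$ (ii) Let $\mathcal R[\Gamma^m]$ and $\mathcal R[\Gamma^{m+1}]$ be corresponding enclosed regions: bounded open sets whose boundaries are embedded closed oriented polyhedral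 surfaces of the same combinatorial structure, made up of some of the surfaces $\Gamma_i$, with $o_i\vec\nu_i$ ($o_i\in\{\pm1\}$) as outer normal, and of further simplices that contain no face of a triple junction line and each either lie in the plane of one of the $\mathcal D_k$ for both clusters or belong to an additional fixed hypersurface. Then $$\operatorname{vol}(\mathcal R[\Gamma^{m+1}])=\operatorname{vol}(\mathcal R[\Gamma^m]).$$ -/

import Mathlib

open MeasureTheory

noncomputable section

namespace ClusterFEM

/-! ### Points and simplices of `ℝ^d`, where `d = n + 2` -/

/-- The Euclidean space `ℝ^d` with `d = n + 2`. -/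
abbrev Pt (n : ℕ) : Type := EuclideanSpace ℝ (Fin (n + 2))

/-- The edges `p₁ - p₀, …, p_m - p₀` of an ordered simplex `(p₀, …, p_m)`. -/
def edges {n m : ℕ} (p : Fin (m + 1) → Pt n) (b : Fin m) : Pt n := p b.succ - p 0

/-- The wedge product of `d - 1` vectors, as a vector of `ℝ^d`: its inner product with `w` is
`det (w, v₁, …, v_{d-1})`. It is the cross product `v₁ × v₂` for `d = 3`, and the rotation of
`v₁` by a right angle for `d = 2`. -/
def wedge {n : ℕ} (v : Fin (n + 1) → Pt n) : Pt n :=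
  WithLp.toLp 2 fun a => Matrix.det (Matrix.of
    (Fin.cons (Pi.single a (1 : ℝ)) (fun b => (v b).ofLp) : Fin (n + 2) → Fin (n + 2) → ℝ))

/-- The orientation vector `A{σ}` of an ordered `(d-1)`-simplex. -/
def orient {n : ℕ} (p : Fin (n + 2) → Pt n) : Pt n := wedge (edges p)

/-- The measure `|σ| = |A{σ}| / (d-1)!` of a `(d-1)`-simplex. -/
def area {n : ℕ} (p : Fin (n + 2) → Pt n) : ℝ := ‖orient p‖ / (n + 1).factorial

/-- The unit normal `A{σ} / |A{σ}|` of an ordered `(d-1)`-simplex. -/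
def unitNormal {n : ℕ} (p : Fin (n + 2) → Pt n) : Pt n := ‖orient p‖⁻¹ • orient p

/-- The measure of an `m`-simplex (for `m = 0` it is `1`, for `m = 1` the length). -/
def simplexMeasure {n m : ℕ} (p : Fin (m + 1) → Pt n) : ℝ :=
  Real.sqrt (Matrix.gram ℝ (edges p)).det / m.factorial

/-- The relatively open simplex with the given vertices. -/
def openSimplex {n m : ℕ} (p : Fin m → Pt n) : Set (Pt n) :=
  {x | ∃ w : Fin m → ℝ, (∀ a, 0 < w a) ∧ ∑ a, w a = 1 ∧ x = ∑ a, w a • p a}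

/-- The closed simplex with the given vertices. -/
def closedSimplex {n m : ℕ} (p : Fin m → Pt n) : Set (Pt n) := convexHull ℝ (Set.range p)

/-- The surface gradient, on the `(d-1)`-simplex with vertices `p`, of the affine function with
nodal values `f`: the tangent vector `g` with `g · (p_a - p₀) = f_a - f₀` for all `a`. -/
def surfGrad {n : ℕ} (p : Fin (n + 2) → Pt n) (f : Fin (n + 2) → ℝ) : Pt n :=
  ∑ a, ∑ b, ((Matrix.gram ℝ (edges p))⁻¹ a b * (f a.succ - f 0)) • edges p b

/-- The directional derivative `∂_t η`, on the `(d-1)`-simplex with vertices `p`, of the affine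
vector field with nodal values `η`: its components are `∇ₛ η_c · t`. -/
def dirDeriv {n : ℕ} (p : Fin (n + 2) → Pt n) (η : Fin (n + 2) → Pt n) (t : Pt n) : Pt n :=
  WithLp.toLp 2 fun c => inner ℝ (surfGrad p fun a => η a c) t

/-! ### Oriented simplicial chains -/

/-- The facet of an ordered simplex opposite to its vertex `a`. The orientation that the simplex
induces on it is `(-1)^a` times the one given by the order of its vertices. -/
def facet {V : Type*} {m : ℕ} (s : Fin (m + 1) → V) (a : Fin (m + 1)) : Fin m → V :=
  fun b => s (a.succAbove b)

/-- `f` and `g` are orderings of the same simplex, and `ε` is their relative orientation. -/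
def SameUpTo {V : Type*} {m : ℕ} (f g : Fin m → V) (ε : ℤ) : Prop :=
  ∃ π : Equiv.Perm (Fin m), g = f ∘ π ∧ ε = (Equiv.Perm.sign π : ℤ)

/-- Alternating simplicial cochains. -/
def IsAlternating {V : Type*} {m : ℕ} (Φ : (Fin m → V) → ℝ) : Prop :=
  ∀ (f : Fin m → V) (π : Equiv.Perm (Fin m)),
    Φ (f ∘ π) = ((Equiv.Perm.sign π : ℤ) : ℝ) * Φ f

/-- The oriented simplicial chain `∑ i, c i • s i` is a cycle: every alternating cochain vanishes
on its boundary, that is, the oriented facets of its simplices cancel. -/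
def IsCycle {V ι : Type*} [Fintype ι] {m : ℕ} (c : ι → ℤ) (s : ι → Fin (m + 1) → V) : Prop :=
  ∀ Φ : (Fin m → V) → ℝ, IsAlternating Φ →
    ∑ i, (c i : ℝ) * ∑ a : Fin (m + 1), (-1 : ℝ) ^ (a : ℕ) * Φ (facet (s i) a) = 0

/-- `R` is a bounded relatively open subset of `A` (the whole space or a hyperplane) whose
boundary in `A` is made up of the simplices with vertices `p i`; these have mutually disjoint
relative interiors, and `w i` is an outer normal to `R` on the `i`-th of them. -/
structure BoundsRegion {n m : ℕ} {ι : Type*} (A : Set (Pt n)) (p : ι → Fin m → Pt n)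
    (w : ι → Pt n) (R : Set (Pt n)) : Prop where
  vertex_mem : ∀ i a, p i a ∈ A
  isOpen : ∃ U : Set (Pt n), IsOpen U ∧ R = A ∩ U
  bounded : Bornology.IsBounded R
  boundary : A ∩ (closure R \ R) ⊆ ⋃ i, closedSimplex (p i)
  outer : ∀ i, ∀ x ∈ openSimplex (p i), ∃ ε > 0, ∀ y ∈ A, dist y x < ε →
    (inner ℝ (y - x) (w i) < 0 → y ∈ R) ∧ (0 < inner ℝ (y - x) (w i) → y ∉ R)
  disjoint : ∀ i i', i ≠ i' → Disjoint (openSimplex (p i)) (openSimplex (p i'))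

/-! ### Triangulated surface clusters -/

/-- The combinatorial data of a triangulated cluster of `nS` surfaces in `ℝ^d`, `d = n + 2`.

The vertices are numbered globally, and vertices that are matched up along a triple junction line
carry the same number. Thus a continuous piecewise affine vector field on the cluster that agrees
along the triple junction lines is a map `Fin nV → Pt n`; in particular so is a parameterization
of the cluster. A scalar finite element function may take different values on the different
surfaces at a triple junction, and is a map `Fin nS → Fin nV → ℝ`, whose value at `i`, `v` is the
nodal value on the `i`-th surface at the vertex `v` (only the vertices of the `i`-th surface
matter).

A pair `(j, a)` stands for the facet of the `j`-th simplex opposite to its `a`-th vertex. -/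
structure Cluster (n : ℕ) where
  /-- the number of vertices -/
  nV : ℕ
  /-- the number of surfaces -/
  nS : ℕ
  /-- the number of simplices of all the surfaces together -/
  nJ : ℕ
  /-- the number of the parts into which the boundaries of the surfaces are partitioned -/
  nP : ℕ
  /-- the number of triple junction lines -/
  nT : ℕ
  /-- the number of boundary lines -/
  nB : ℕ
  nS_pos : 0 < nS
  /-- the ordered vertices of a simplex -/
  simplex : Fin nJ → Fin (n + 2) → Fin nV
  /-- the surface to which a simplex belongs -/
  surf : Fin nJ → Fin nS
  /-- the surface to whose boundary a part belongs -/
  partSurf : Fin nP → Fin nS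
  /-- the facets that make up a part -/
  part : Fin nP → Finset (Fin nJ × Fin (n + 2))
  /-- the three boundary parts that meet in a triple junction line -/
  tjPart : Fin nT → Fin 3 → Fin nP
  /-- the orientations `o_1, o_2, o_3` at a triple junction line -/
  tjSign : Fin nT → Fin 3 → ℤ
  /-- the boundary part that makes up a boundary line -/
  bdPart : Fin nB → Fin nP
  simplex_injective : ∀ j, Function.Injective (simplex j)
  surf_surjective : Function.Surjective surf
  part_nonempty : ∀ q, (part q).Nonempty
  part_surf : ∀ q, ∀ F ∈ part q, surf F.1 = partSurf q
  /-- different parts of the boundary have no facet in common -/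
  part_disjoint : ∀ q q', ∀ F ∈ part q, F ∈ part q' → q = q'
  /-- a boundary facet of a surface belongs to only one simplex of this surface -/
  part_boundary : ∀ q, ∀ F ∈ part q, ∀ (F' : Fin nJ × Fin (n + 2)) (ε : ℤ),
    surf F'.1 = surf F.1 →
      SameUpTo (facet (simplex F.1) F.2) (facet (simplex F'.1) F'.2) ε → F' = F
  /-- every other facet is shared by exactly two simplices of the surface, which induce opposite
  orientations on it -/
  interior : ∀ F : Fin nJ × Fin (n + 2), (∀ q, F ∉ part q) →
    ∃ F' : Fin nJ × Fin (n + 2), F' ≠ F ∧ surf F'.1 = surf F.1 ∧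
      (∃ ε : ℤ, SameUpTo (facet (simplex F.1) F.2) (facet (simplex F'.1) F'.2) ε ∧
        (-1) ^ (F'.2 : ℕ) * ε = -(-1) ^ (F.2 : ℕ)) ∧
      ∀ (F'' : Fin nJ × Fin (n + 2)) (ε : ℤ), surf F''.1 = surf F.1 →
        SameUpTo (facet (simplex F.1) F.2) (facet (simplex F''.1) F''.2) ε → F'' = F ∨ F'' = F'
  /-- three different surfaces meet at a triple junction line -/
  tj_surf : ∀ k, StrictMono fun j => partSurf (tjPart k j)
  tjPart_injective : ∀ k k' j j', tjPart k j = tjPart k' j' → k = k'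
  tjSign_eq : ∀ k j, tjSign k j = 1 ∨ tjSign k j = -1
  /-- the triangulations of the three surfaces match up at a triple junction line; multiplied by
  `o_j`, the orientations that they induce on it agree, which means that the pairs
  `(o_j ν_j, μ_j)` of normal and conormal have the same orientation -/
  tj_match : ∀ k j j', ∀ F ∈ part (tjPart k j), ∃ F' ∈ part (tjPart k j'), ∃ ε : ℤ,
    SameUpTo (facet (simplex F.1) F.2) (facet (simplex F'.1) F'.2) ε ∧
      tjSign k j * (-1) ^ (F.2 : ℕ) = tjSign k j' * (-1) ^ (F'.2 : ℕ) * ε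
  /-- different surfaces have facets in common only at triple junction lines -/
  tj_facet : ∀ (F F' : Fin nJ × Fin (n + 2)) (ε : ℤ), surf F.1 ≠ surf F'.1 →
    SameUpTo (facet (simplex F.1) F.2) (facet (simplex F'.1) F'.2) ε →
      ∃ k j j', F ∈ part (tjPart k j) ∧ F' ∈ part (tjPart k j')
  /-- different surfaces have vertices in common only as a result of the matching at triple
  junction lines -/
  tj_vertex : ∀ v j j' a a', simplex j a = v → simplex j' a' = v →
    Relation.ReflTransGen (fun i i' => ∃ k l l', partSurf (tjPart k l) = i ∧
      partSurf (tjPart k l') = i' ∧ (∃ F ∈ part (tjPart k l), ∃ b, facet (simplex F.1) F.2 b = v))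
      (surf j) (surf j')
  /-- no triple junction line is constrained to lie on the external boundary -/
  bd_tj : ∀ k k' j, bdPart k ≠ tjPart k' j

namespace Cluster

variable {n : ℕ} (M : Cluster n)

/-- The ordered vertices of a facet. -/
def facetVertex (F : Fin M.nJ × Fin (n + 2)) : Fin (n + 1) → Fin M.nV :=
  facet (M.simplex F.1) F.2

/-- The vertex `v` lies on the boundary part `q`. -/
def OnPart (q : Fin M.nP) (v : Fin M.nV) : Prop := ∃ F ∈ M.part q, ∃ b, M.facetVertex F b = v

/-- The vertices of the `j`-th simplex of the cluster parameterized by `X`. -/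
def pos (X : Fin M.nV → Pt n) (j : Fin M.nJ) : Fin (n + 2) → Pt n := fun a => X (M.simplex j a)

/-- The vertices of a facet of the cluster parameterized by `X`. -/
def facetPos (X : Fin M.nV → Pt n) (F : Fin M.nJ × Fin (n + 2)) : Fin (n + 1) → Pt n :=
  fun b => X (M.facetVertex F b)

/-- The boundary line `B_k` of the cluster parameterized by `X`, as a point set. -/
def boundaryLine (X : Fin M.nV → Pt n) (k : Fin M.nB) : Set (Pt n) :=
  ⋃ F ∈ M.part (M.bdPart k), closedSimplex (M.facetPos X F)

/-- The scalar finite element space `W^h`. -/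
def MemW (χ : Fin M.nS → Fin M.nV → ℝ) : Prop :=
  ∀ k v, M.OnPart (M.tjPart k 0) v →
    ∑ j : Fin 3, (M.tjSign k j : ℝ) * χ (M.partSurf (M.tjPart k j)) v = 0

/-- The vectorial finite element space `V^h_∂`, where `nrm k` is the normal to the `k`-th external
plane. -/
def MemVbd (nrm : Fin M.nB → Pt n) (η : Fin M.nV → Pt n) : Prop :=
  ∀ k v, M.OnPart (M.bdPart k) v → inner ℝ (nrm k) (η v) = 0

/-- The linear interpolation between the parameterizations at the times `t₀` and `t₁`. -/
def interp (t₀ t₁ : ℝ) (X₀ X₁ : Fin M.nV → Pt n) (t : ℝ) : Fin M.nV → Pt n :=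
  fun v => ((t₁ - t) / (t₁ - t₀)) • X₀ v + ((t - t₀) / (t₁ - t₀)) • X₁ v

/-- The time-weighted normal `ν^{m+1/2}` on the `j`-th simplex. -/
def nuHalf (t₀ t₁ : ℝ) (X₀ X₁ : Fin M.nV → Pt n) (j : Fin M.nJ) : Pt n :=
  (1 / ((t₁ - t₀) * ‖orient (M.pos X₀ j)‖)) •
    ∫ t in t₀..t₁, orient (M.pos (M.interp t₀ t₁ X₀ X₁ t) j)

/-- The conormal `ξ_k` on a facet of `B_k`, up to a positive factor: for `d = 3` it is `n_k × f`,
where `f` is the edge vector of the facet in the direction of `μ × ν`, opposite to the induced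
orientation; for `d = 2` it is the rotation of `n_k` by a right angle for which `(n_k, ξ_k)` has
the orientation of `(ν, μ)`. -/
def xiVec (nrm : Fin M.nB → Pt n) (k : Fin M.nB) (X : Fin M.nV → Pt n)
    (F : Fin M.nJ × Fin (n + 2)) : Pt n :=
  (-(-1 : ℝ) ^ (F.2 : ℕ)) • wedge (Fin.cons (nrm k) (edges (M.facetPos X F)))

/-- The time-weighted conormal `ξ_k^{m+1/2}` on a facet of `B_k^m`. -/
def xiHalf (nrm : Fin M.nB → Pt n) (k : Fin M.nB) (t₀ t₁ : ℝ) (X₀ X₁ : Fin M.nV → Pt n)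
    (F : Fin M.nJ × Fin (n + 2)) : Pt n :=
  (1 / ((t₁ - t₀) * simplexMeasure (M.facetPos X₀ F))) •
    ∫ t in t₀..t₁, M.xiVec nrm k (M.interp t₀ t₁ X₀ X₁ t) F

/-- The mass-lumped integral over the cluster of a piecewise continuous function; `f j a` is its
limit in the `j`-th simplex at the `a`-th vertex. -/
def lumped (X : Fin M.nV → Pt n) (f : Fin M.nJ → Fin (n + 2) → ℝ) : ℝ :=
  1 / (n + 2) * ∑ j, area (M.pos X j) * ∑ a, f j a

/-- The inner product `⟨∇ₛ κ, ∇ₛ χ⟩` over the cluster parameterized by `X`. -/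
def gradForm (X : Fin M.nV → Pt n) (κ χ : Fin M.nS → Fin M.nV → ℝ) : ℝ :=
  ∑ j, area (M.pos X j) *
    inner ℝ (surfGrad (M.pos X j) fun a => κ (M.surf j) (M.simplex j a))
      (surfGrad (M.pos X j) fun a => χ (M.surf j) (M.simplex j a))

/-- The boundary term `∑ k, ϱ_k ∫_{B_k^m} ξ_k^{m+1/2} · η`. The integrand is affine on each facet,
so its integral is the measure of the facet times the mean of the nodal values. -/
def boundaryTerm (nrm : Fin M.nB → Pt n) (ϱ : Fin M.nB → ℝ) (t₀ t₁ : ℝ)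
    (X₀ X₁ : Fin M.nV → Pt n) (η : Fin M.nV → Pt n) : ℝ :=
  ∑ k, ϱ k * ∑ F ∈ M.part (M.bdPart k), simplexMeasure (M.facetPos X₀ F) *
    (1 / (n + 1) * ∑ b, inner ℝ (M.xiHalf nrm k t₀ t₁ X₀ X₁ F) (η (M.facetVertex F b)))

end Cluster

/-! ### Anisotropies -/

/-- The anisotropies `γ(p) = (∑ ℓ, γ_ℓ(p)^r)^(1/r)`, `γ_ℓ(p) = √(p · G_ℓ p)`. -/
structure Anisotropy (n : ℕ) where
  L : ℕ
  L_pos : 0 < L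
  r : ℝ
  one_le_r : 1 ≤ r
  G : Fin L → Matrix (Fin (n + 2)) (Fin (n + 2)) ℝ
  posDef : ∀ ℓ, (G ℓ).PosDef

namespace Anisotropy

variable {n : ℕ} (γ : Anisotropy n)

/-- The function `γ_ℓ`. -/
def component (ℓ : Fin γ.L) (p : Pt n) : ℝ := Real.sqrt (p.ofLp ⬝ᵥ (γ.G ℓ).mulVec p.ofLp)

/-- The surface energy density `γ`. -/
def density (p : Pt n) : ℝ := (∑ ℓ, γ.component ℓ p ^ γ.r) ^ (1 / γ.r)

/-- The inner product `(x, y)_{G̃_ℓ} = x · G̃_ℓ y`, where `G̃_ℓ = (det G_ℓ)^(1/(d-1)) G_ℓ⁻¹`. -/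
def dualInner (ℓ : Fin γ.L) (x y : Pt n) : ℝ :=
  x.ofLp ⬝ᵥ (((γ.G ℓ).det ^ (1 / ((n : ℝ) + 1))) • (γ.G ℓ)⁻¹).mulVec y.ofLp

/-- `t` consists, for each simplex of the cluster and each `ℓ`, of a basis of the tangent plane
that is orthonormal for the `G̃_ℓ`-inner product. -/
def IsFrame (M : Cluster n) (X : Fin M.nV → Pt n)
    (t : Fin M.nJ → Fin γ.L → Fin (n + 1) → Pt n) : Prop :=
  ∀ j ℓ, (∀ a, inner ℝ (t j ℓ a) (unitNormal (M.pos X j)) = 0) ∧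
    ∀ a b, γ.dualInner ℓ (t j ℓ a) (t j ℓ b) = if a = b then 1 else 0

/-- The form `⟨∇ₛ^G̃ η, ∇ₛ^G̃ χ⟩_γ` over the old cluster `X₀`, with the weights that depend on the
normals of the new cluster `X₁`; here `(∇ₛ^G̃ η, ∇ₛ^G̃ χ)_G̃` is `∑ a, (∂_{t_a} η, ∂_{t_a} χ)_G̃`. -/
def form (M : Cluster n) (X₀ X₁ : Fin M.nV → Pt n)
    (t : Fin M.nJ → Fin γ.L → Fin (n + 1) → Pt n) (η χ : Fin M.nV → Pt n) : ℝ :=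
  ∑ j, area (M.pos X₀ j) * ∑ ℓ,
    (γ.component ℓ (unitNormal (M.pos X₁ j)) / γ.density (unitNormal (M.pos X₁ j))) ^ (γ.r - 1) *
      (∑ a, γ.dualInner ℓ (dirDeriv (M.pos X₀ j) (M.pos η j) (t j ℓ a))
        (dirDeriv (M.pos X₀ j) (M.pos χ j) (t j ℓ a))) *
      γ.component ℓ (unitNormal (M.pos X₀ j))

/-- The anisotropic surface energy `A_γ`. -/
def surfaceEnergy (M : Cluster n) (X : Fin M.nV → Pt n) : ℝ :=
  ∑ j, area (M.pos X j) * γ.density (unitNormal (M.pos X j))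

end Anisotropy

/-! ### The scheme -/

/-- `(X₁, κ)` is a solution of one step, from the cluster `X₀` at time `t₀` to time `t₁`, of the
anisotropic scheme with the boundary term for non-neutral external boundaries. -/
structure IsSolution {n : ℕ} (M : Cluster n) (γ : Anisotropy n) (nrm : Fin M.nB → Pt n)
    (ϱ : Fin M.nB → ℝ) (t₀ t₁ : ℝ) (X₀ : Fin M.nV → Pt n)
    (frame : Fin M.nJ → Fin γ.L → Fin (n + 1) → Pt n)
    (X₁ : Fin M.nV → Pt n) (κ : Fin M.nS → Fin M.nV → ℝ) : Prop where
  mem_W : M.MemW κ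
  mem_V : M.MemVbd nrm fun v => X₁ v - X₀ v
  velocity_eq : ∀ χ, M.MemW χ →
    1 / (t₁ - t₀) * M.lumped X₀ (fun j a =>
        inner ℝ (X₁ (M.simplex j a) - X₀ (M.simplex j a))
          (χ (M.surf j) (M.simplex j a) • M.nuHalf t₀ t₁ X₀ X₁ j))
      - M.gradForm X₀ κ χ = 0
  curvature_eq : ∀ η, M.MemVbd nrm η →
    M.lumped X₀ (fun j a =>
        inner ℝ (κ (M.surf j) (M.simplex j a) • M.nuHalf t₀ t₁ X₀ X₁ j) (η (M.simplex j a)))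
      + γ.form M X₀ X₁ frame X₁ η
      = M.boundaryTerm nrm ϱ t₀ t₁ X₀ X₁ η

/-! ### Enclosed regions -/

/-- The hyperplane with normal `e` and offset `c`. -/
def hyperplane {n : ℕ} (e : Pt n) (c : ℝ) : Set (Pt n) := {x | inner ℝ e x = c}

/-- The combinatorial description of the boundary of an enclosed region: a closed oriented
polyhedral surface that consists of some of the surfaces of the cluster, with the orientations
`o`, and of further simplices, which may use auxiliary vertices and belong to the external planes
(`capPlane c = some k`) or to an additional fixed hypersurface (`capPlane c = none`). -/
structure RegionBoundary {n : ℕ} (M : Cluster n) where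
  surfs : Finset (Fin M.nS)
  o : Fin M.nS → ℤ
  o_eq : ∀ i, o i = 1 ∨ o i = -1
  planes : Finset (Fin M.nB)
  /-- the number of auxiliary vertices -/
  nA : ℕ
  /-- the number of simplices in the external planes and the fixed hypersurface -/
  nC : ℕ
  cap : Fin nC → Fin (n + 2) → Fin M.nV ⊕ Fin nA
  capPlane : Fin nC → Option (Fin M.nB)
  capPlane_mem : ∀ c k, capPlane c = some k → k ∈ planes
  /-- the external planes and the fixed hypersurface contain no facet of a triple junction line -/
  cap_tj : ∀ c a k j, ∀ F ∈ M.part (M.tjPart k j), ∀ ε,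
    ¬ SameUpTo (fun b => Sum.inl (M.facetVertex F b)) (facet (cap c) a) ε
  closed : IsCycle
    (Sum.elim (fun j : {j : Fin M.nJ // M.surf j ∈ surfs} => o (M.surf j)) (fun _ : Fin nC => 1))
    (Sum.elim (fun j : {j : Fin M.nJ // M.surf j ∈ surfs} =>
      fun a => (Sum.inl (M.simplex j a) : Fin M.nV ⊕ Fin nA)) cap)

namespace RegionBoundary

variable {n : ℕ} {M : Cluster n} (S : RegionBoundary M)

/-- `R` is the region enclosed by the surfaces of the cluster `X`, the external planes and the
fixed hypersurface, when the auxiliary vertices are at `P`; the vectors `o_i ν_i` are outer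
normals to it. -/
def IsRegion (X : Fin M.nV → Pt n) (P : Fin S.nA → Pt n) (R : Set (Pt n)) : Prop :=
  BoundsRegion Set.univ
    (Sum.elim (fun j : {j : Fin M.nJ // M.surf j ∈ S.surfs} => M.pos X j)
      (fun c a => Sum.elim X P (S.cap c a)))
    (Sum.elim (fun j : {j : Fin M.nJ // M.surf j ∈ S.surfs} =>
        (S.o (M.surf j) : ℝ) • orient (M.pos X j))
      (fun c => orient fun a => Sum.elim X P (S.cap c a))) R

/-- The simplices that complete the boundary of the region lie in the external planes at both
times, or else do not move. -/
def CapsFixed (nrm : Fin M.nB → Pt n) (off : Fin M.nB → ℝ) (X₀ X₁ : Fin M.nV → Pt n)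
    (P₀ P₁ : Fin S.nA → Pt n) : Prop :=
  ∀ c a, (∀ k, S.capPlane c = some k →
      Sum.elim X₀ P₀ (S.cap c a) ∈ hyperplane (nrm k) (off k) ∧
      Sum.elim X₁ P₁ (S.cap c a) ∈ hyperplane (nrm k) (off k)) ∧
    (S.capPlane c = none → Sum.elim X₀ P₀ (S.cap c a) = Sum.elim X₁ P₁ (S.cap c a))

end RegionBoundary

/-! ### Contact areas -/

/-- `(d-2)`-simplices, possibly with auxiliary vertices, that complete the boundary line `B_k` to
the oriented boundary of a region of the external plane (none are needed if `B_k` is a closed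
curve and the region is its interior). -/
structure ContactClosure {n : ℕ} (M : Cluster n) (k : Fin M.nB) where
  /-- the number of auxiliary vertices -/
  nA : ℕ
  /-- the number of additional simplices -/
  nC : ℕ
  cap : Fin nC → Fin (n + 1) → Fin M.nV ⊕ Fin nA
  sign : Fin nC → ℤ
  sign_eq : ∀ c, sign c = 1 ∨ sign c = -1
  /-- for `d = 3` the completed line is a closed polygonal curve -/
  closed : 1 ≤ n → IsCycle
    (Sum.elim (fun F : {F // F ∈ M.part (M.bdPart k)} => -(-1 : ℤ) ^ (F.1.2 : ℕ)) sign)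
    (Sum.elim (fun F : {F // F ∈ M.part (M.bdPart k)} =>
      fun b => (Sum.inl (M.facetVertex F.1 b) : Fin M.nV ⊕ Fin nA)) cap)

namespace ContactClosure

variable {n : ℕ} {M : Cluster n} {k : Fin M.nB} (K : ContactClosure M k)

/-- `Q` is the region of the `k`-th external plane that is bounded by the boundary line `B_k` of
the cluster `X`, to which `ξ_k` is an outer normal, and the additional simplices, when the
auxiliary vertices are at `P`. -/
def IsRegion (nrm : Fin M.nB → Pt n) (off : Fin M.nB → ℝ) (X : Fin M.nV → Pt n)
    (P : Fin K.nA → Pt n) (Q : Set (Pt n)) : Prop :=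
  BoundsRegion (hyperplane (nrm k) (off k))
    (Sum.elim (fun F : {F // F ∈ M.part (M.bdPart k)} => M.facetPos X F)
      (fun c b => Sum.elim X P (K.cap c b)))
    (Sum.elim (fun F : {F // F ∈ M.part (M.bdPart k)} => M.xiVec nrm k X F)
      (fun c => (K.sign c : ℝ) •
        wedge (Fin.cons (nrm k) (edges fun b => Sum.elim X P (K.cap c b))))) Q

/-- Each additional simplex moves only within a fixed `(d-2)`-plane of the external plane, such as
an edge of the external boundary along which an end of `B_k` slides. -/
def CapsFixed (nrm : Fin M.nB → Pt n) (X₀ X₁ : Fin M.nV → Pt n)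
    (P₀ P₁ : Fin K.nA → Pt n) : Prop :=
  ∀ c, ∃ (e : Pt n) (b : ℝ), e ≠ 0 ∧ inner ℝ (nrm k) e = 0 ∧ ∀ a,
    Sum.elim X₀ P₀ (K.cap c a) ∈ hyperplane e b ∧ Sum.elim X₁ P₁ (K.cap c a) ∈ hyperplane e b

end ContactClosure

/-- The boundary line `B` divides the set `𝒢` (the part of an external planar surface in a large
ball) into the two parts `Gp` and `Gm`. -/
structure Divides {n : ℕ} (B 𝒢 Gp Gm : Set (Pt n)) : Prop where
  union_eq : Gp ∪ Gm ∪ B = 𝒢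
  disjoint : Disjoint Gp Gm
  disjoint_line : Disjoint (Gp ∪ Gm) B
  closure_inter : closure Gp ∩ closure Gm = B

/-- The pieces `𝒢_k^±` into which the boundary lines `B_k` divide the external planar surfaces
`D_k`, cut off by a large ball, for the clusters `X₀` and `X₁`. The part `𝒢_k^-` is the one to
which `ξ_k` is an outer normal on `B_k`: up to a set of measure zero it consists of a polygonal
region with the outer normal `ξ_k` on `B_k`, and of a set `C k` away from the boundary line, which
is the same for both clusters. -/
structure ContactParts {n : ℕ} (M : Cluster n) (nrm : Fin M.nB → Pt n) (off : Fin M.nB → ℝ)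
    (X₀ X₁ : Fin M.nV → Pt n) where
  /-- the external planar surfaces -/
  D : Fin M.nB → Set (Pt n)
  isClosed_D : ∀ k, IsClosed (D k)
  D_subset : ∀ k, D k ⊆ hyperplane (nrm k) (off k)
  /-- the radius of the ball -/
  Rad : ℝ
  Gp₀ : Fin M.nB → Set (Pt n)
  Gm₀ : Fin M.nB → Set (Pt n)
  Gp₁ : Fin M.nB → Set (Pt n)
  Gm₁ : Fin M.nB → Set (Pt n)
  divides₀ : ∀ k, Divides (M.boundaryLine X₀ k) (D k ∩ Metric.closedBall 0 Rad) (Gp₀ k) (Gm₀ k)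
  divides₁ : ∀ k, Divides (M.boundaryLine X₁ k) (D k ∩ Metric.closedBall 0 Rad) (Gp₁ k) (Gm₁ k)
  K : ∀ k, ContactClosure M k
  P₀ : ∀ k, Fin (K k).nA → Pt n
  P₁ : ∀ k, Fin (K k).nA → Pt n
  capsFixed : ∀ k, (K k).CapsFixed nrm X₀ X₁ (P₀ k) (P₁ k)
  Q₀ : Fin M.nB → Set (Pt n)
  Q₁ : Fin M.nB → Set (Pt n)
  isRegion₀ : ∀ k, (K k).IsRegion nrm off X₀ (P₀ k) (Q₀ k)
  isRegion₁ : ∀ k, (K k).IsRegion nrm off X₁ (P₁ k) (Q₁ k)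
  C : Fin M.nB → Set (Pt n)
  measurableSet_C : ∀ k, MeasurableSet (C k)
  disjoint₀ : ∀ k, Disjoint (Q₀ k) (C k)
  disjoint₁ : ∀ k, Disjoint (Q₁ k) (C k)
  Gm₀_eq : ∀ k, Gm₀ k =ᵐ[Measure.euclideanHausdorffMeasure (n + 1)] (Q₀ k ∪ C k : Set (Pt n))
  Gm₁_eq : ∀ k, Gm₁ k =ᵐ[Measure.euclideanHausdorffMeasure (n + 1)] (Q₁ k ∪ C k : Set (Pt n))

/-- The contact energy `∑ k, (ϱ̂_k^+ |𝒢_k^+| + ϱ̂_k^- |𝒢_k^-|)`. -/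
def contactEnergy {n N : ℕ} (ϱp ϱm : Fin N → ℝ) (Gp Gm : Fin N → Set (Pt n)) : ℝ :=
  ∑ k, (ϱp k * (Measure.euclideanHausdorffMeasure (n + 1)).real (Gp k) +
    ϱm k * (Measure.euclideanHausdorffMeasure (n + 1)).real (Gm k))

end ClusterFEM

end

/-!
Both claims come from testing the scheme with suitable functions, once the energies and volumes are
expressed through nodal values.

*Volumes.* The volume of a polyhedral region is, up to a constant, the signed sum of the
determinants of the vertices of its boundary simplices (`Encloses.volume_eq`). For a point `x` in
general position the ray from `x` away from the origin meets the boundary only in relative interiors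
of simplices, transversally and at distinct points, and the indicator of the region at `x` is the
signed number of these crossings (`Encloses.indicator_eq_sum`); the points whose ray crosses a given
simplex form the cone over this simplex, whose volume is a determinant. By an isometric
parameterization of a hyperplane the same formula gives the contact areas
(`BoundsRegion.hausdorff_eq`).

*Fluxes.* Along the linear interpolation in time the sum of the determinants is a polynomial, and
since the boundary is a simplicial cycle its derivative is the flux of the velocity through the
boundary (`IsCycle.sum_sub_eq_integral`). The simplices in the external planes do not contribute, so
the change of a volume or of a contact area is the integral of the displacement against the
time-weighted normals or conormals (`RegionBoundary.volume_sub`, `ContactClosure.hausdorff_sub`).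

*Energy.* The form at the displacement bounds the change of the surface energy
(`Anisotropy.surfaceEnergy_sub_le_form`). The reason is that `γ_ℓ` of a normal is the area with
respect to the metric `G̃_ℓ`, so that for each `ℓ` the bound is the arithmetic-geometric mean
inequality for the Gram matrix of at most two vectors; the sum over `ℓ` is Hölder's inequality. The
right-hand side of the curvature equation at the displacement is the decrease of the contact energy,
and the velocity equation at the curvature gives the dissipation term.

*Conservation.* The volume flux is the velocity equation tested with the oriented indicator of the
surfaces that bound the region. It lies in `W^h` because the oriented facets of the boundary cancel
along each triple junction line (`RegionBoundary.memW_indicator`), and its gradient vanishes.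
-/

namespace ClusterFEM

/-! ### Signed crossings on a line -/

section Crossing

open Filter Topology

/-- A function that has a constant value near each point, except possibly at the point itself, has
the same constant value near all points, as the local values form a locally constant function. -/
theorem exists_forall_eventually_eq_punctured {f : ℝ → ℝ}
    (hf : ∀ x, ∃ c, ∀ᶠ y in 𝓝[≠] x, f y = c) : ∃ c, ∀ x, ∀ᶠ y in 𝓝[≠] x, f y = c := by
  choose H hH using hf
  have hloc : IsLocallyConstant H := by
    rw [IsLocallyConstant.iff_eventually_eq]
    intro x
    have h2 : ∀ᶠ y in 𝓝[≠] x, H y = H x := by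
      have h3 := eventually_eventually_nhdsWithin.2 (hH x)
      filter_upwards [h3, self_mem_nhdsWithin] with y hy hyx
      have h4 : ∀ᶠ z in 𝓝 y, f z = H x := by
        rwa [IsOpen.nhdsWithin_eq isOpen_compl_singleton hyx] at hy
      obtain ⟨z, hz1, hz2⟩ := ((h4.filter_mono nhdsWithin_le_nhds).and (hH y)).exists
      rw [← hz2, hz1]
    rw [eventually_nhdsWithin_iff] at h2
    filter_upwards [h2] with y hy
    by_cases h : y = x
    · rw [h]
    · exact hy h
  refine ⟨H 0, fun x => ?_⟩
  have := hloc.apply_eq_of_preconnectedSpace x 0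
  rw [← this]
  exact hH x

theorem eventually_step_eq (t x : ℝ) (h : t ≠ x) :
    ∀ᶠ y in 𝓝 x, (if y < t then (1 : ℝ) else 0) = if x < t then 1 else 0 := by
  rcases lt_or_gt_of_ne h with h | h
  · filter_upwards [lt_mem_nhds h] with y hy
    rw [if_neg (not_lt.2 hy.le), if_neg (not_lt.2 h.le)]
  · filter_upwards [gt_mem_nhds h] with y hy
    rw [if_pos hy, if_pos h]

/-- A function that vanishes near `+∞` and is locally constant except for jumps of height `-s i` at
finitely many distinct points `t i` is the sum of the corresponding step functions. -/
theorem eq_sum_jumps {ι : Type*} (I : Finset ι) (t s : ι → ℝ) (f : ℝ → ℝ)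
    (hinj : Set.InjOn t I)
    (hreg : ∀ x, (∀ i ∈ I, t i ≠ x) → ∀ᶠ y in 𝓝 x, f y = f x)
    (hjump : ∀ i ∈ I, ∃ c, ∀ᶠ y in 𝓝[≠] (t i), f y - s i * (if y < t i then 1 else 0) = c)
    (hinf : ∀ᶠ y in atTop, f y = 0) (x : ℝ) (hx : ∀ i ∈ I, t i ≠ x) :
    f x = ∑ i ∈ I, s i * if x < t i then 1 else 0 := by
  classical
  set h : ℝ → ℝ := fun y => f y - ∑ i ∈ I, s i * if y < t i then 1 else 0 with hh
  have hsteps : ∀ x, ∀ J ⊆ I, (∀ i ∈ J, t i ≠ x) → ∀ᶠ y in 𝓝 x,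
      (∑ i ∈ J, s i * if y < t i then (1 : ℝ) else 0)
        = ∑ i ∈ J, s i * if x < t i then (1 : ℝ) else 0 := by
    intro x J _ hJ
    have : ∀ᶠ y in 𝓝 x, ∀ i ∈ J, (if y < t i then (1 : ℝ) else 0) = if x < t i then 1 else 0 :=
      (Filter.eventually_all_finset J).2 fun i hi => eventually_step_eq _ _ (hJ i hi)
    filter_upwards [this] with y hy
    exact Finset.sum_congr rfl fun i hi => by rw [hy i hi]
  have hhreg : ∀ x, (∀ i ∈ I, t i ≠ x) → ∀ᶠ y in 𝓝 x, h y = h x := by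
    intro x hx
    filter_upwards [hsteps x I subset_rfl hx, hreg x hx] with y h1 h2
    simp only [hh, h1, h2]
  have hloc : ∀ x, ∃ c, ∀ᶠ y in 𝓝[≠] x, h y = c := by
    intro x
    by_cases hx : ∀ i ∈ I, t i ≠ x
    · exact ⟨h x, (hhreg x hx).filter_mono nhdsWithin_le_nhds⟩
    · push Not at hx
      obtain ⟨i, hi, rfl⟩ := hx
      obtain ⟨c, hc⟩ := hjump i hi
      have hrest := hsteps (t i) (I.erase i) (Finset.erase_subset _ _) (by
        intro j hj hji
        exact (Finset.ne_of_mem_erase hj)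
          (hinj (Finset.mem_of_mem_erase hj) hi hji))
      refine ⟨c - ∑ j ∈ I.erase i, s j * if t i < t j then 1 else 0, ?_⟩
      filter_upwards [hc, hrest.filter_mono nhdsWithin_le_nhds] with y h1 h2
      simp only [hh]
      rw [← Finset.add_sum_erase I _ hi, h2, ← sub_sub, h1]
  obtain ⟨c, hc⟩ := exists_forall_eventually_eq_punctured hloc
  have hc0 : c = 0 := by
    have hfar : ∀ᶠ y in atTop, h y = 0 ∧ ∀ i ∈ I, t i ≠ y := by
      have : ∀ᶠ y in atTop, ∀ i ∈ I, t i < y :=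
        (Filter.eventually_all_finset I).2 fun i _ => eventually_gt_atTop _
      filter_upwards [this, hinf] with y hy h0
      refine ⟨?_, fun i hi => (hy i hi).ne⟩
      simp only [hh, h0]
      rw [Finset.sum_eq_zero, sub_zero]
      intro i hi
      rw [if_neg (not_lt.2 (hy i hi).le), mul_zero]
    obtain ⟨y, hy0, hyI⟩ := hfar.exists
    obtain ⟨z, h1, h2⟩ := (((hhreg y hyI).filter_mono nhdsWithin_le_nhds).and (hc y)).exists
    rw [← h2, h1, hy0]
  obtain ⟨z, h1, h2⟩ := (((hhreg x hx).filter_mono nhdsWithin_le_nhds).and (hc x)).exists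
  have : h x = 0 := by rw [← h1, h2, hc0]
  simp only [hh] at this
  linarith

end Crossing

/-! ### The volume of a polyhedral region -/

/-- The relatively open simplex with the given vertices, in an arbitrary real vector space. -/
def simplexInterior {E : Type*} [AddCommGroup E] [Module ℝ E] {m : ℕ} (p : Fin m → E) : Set E :=
  {x | ∃ w : Fin m → ℝ, (∀ a, 0 < w a) ∧ ∑ a, w a = 1 ∧ x = ∑ a, w a • p a}

/-- `R` is a bounded open set whose boundary is made up of the simplices with vertices `p i`, which
have mutually disjoint relative interiors, and `w i` is an outer normal on the `i`-th of them. -/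
structure Encloses {E : Type*} [NormedAddCommGroup E] [InnerProductSpace ℝ E] {m : ℕ} {ι : Type*}
    (p : ι → Fin m → E) (w : ι → E) (R : Set E) : Prop where
  isOpen : IsOpen R
  bounded : Bornology.IsBounded R
  boundary : closure R \ R ⊆ ⋃ i, convexHull ℝ (Set.range (p i))
  outer : ∀ i, ∀ x ∈ simplexInterior (p i), ∃ ε > 0, ∀ y, dist y x < ε →
    (inner ℝ (y - x) (w i) < 0 → y ∈ R) ∧ (0 < inner ℝ (y - x) (w i) → y ∉ R)
  disjoint : ∀ i i', i ≠ i' → Disjoint (simplexInterior (p i)) (simplexInterior (p i'))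

section Ray

open Filter Topology

variable {E : Type*} [NormedAddCommGroup E] [InnerProductSpace ℝ E] {m : ℕ} {ι : Type*}

theorem exists_weights_of_mem_convexHull {p : Fin m → E} {x : E}
    (hx : x ∈ convexHull ℝ (Set.range p)) :
    ∃ w : Fin m → ℝ, (∀ a, 0 ≤ w a) ∧ ∑ a, w a = 1 ∧ x = ∑ a, w a • p a := by
  rw [mem_convexHull_iff_exists_fintype] at hx
  obtain ⟨κ, _, w, z, hw0, hw1, hz, rfl⟩ := hx
  choose g hg using hz
  classical
  refine ⟨fun a => ∑ i ∈ Finset.univ.filter (fun i => g i = a), w i,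
    fun a => Finset.sum_nonneg fun i _ => hw0 i, ?_, ?_⟩
  · rw [Finset.sum_fiberwise]; exact hw1
  · simp_rw [Finset.sum_smul]
    rw [← Finset.sum_fiberwise Finset.univ g]
    refine Finset.sum_congr rfl fun a _ => Finset.sum_congr rfl fun i hi => ?_
    rw [← (Finset.mem_filter.1 hi).2, hg]

theorem simplexInterior_subset (p : Fin m → E) :
    simplexInterior p ⊆ convexHull ℝ (Set.range p) := by
  rintro x ⟨w, h0, h1, rfl⟩
  exact (convex_convexHull ℝ _).sum_mem (fun a _ => (h0 a).le) h1
    fun a _ => subset_convexHull ℝ _ ⟨a, rfl⟩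

theorem inner_eq_of_mem_convexHull {p : Fin m → E} {w : E} {c : ℝ} (h : ∀ a, inner ℝ (p a) w = c)
    {x : E} (hx : x ∈ convexHull ℝ (Set.range p)) : inner ℝ x w = c := by
  obtain ⟨v, -, h1, rfl⟩ := exists_weights_of_mem_convexHull hx
  simp_rw [sum_inner, inner_smul_left, h, ← Finset.sum_mul]
  simp [h1]

theorem Encloses.eventually_mem_iff {p : ι → Fin m → E} {w : ι → E} {R : Set E}
    (h : Encloses p w R) {x : E} (hx : ∀ i, x ∉ convexHull ℝ (Set.range (p i))) :
    ∀ᶠ y in 𝓝 x, (y ∈ R ↔ x ∈ R) := by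
  by_cases hxR : x ∈ R
  · filter_upwards [h.isOpen.mem_nhds hxR] with y hy
    simp [hy, hxR]
  · have hxc : x ∉ closure R := fun hc => by
      obtain ⟨i, hi⟩ := Set.mem_iUnion.1 (h.boundary ⟨hc, hxR⟩)
      exact hx i hi
    filter_upwards [isClosed_closure.isOpen_compl.mem_nhds hxc] with y hy
    have : y ∉ R := fun h => hy (subset_closure h)
    simp [this, hxR]

/-- The indicator of a polyhedral region at a point `x` in general position is the signed number
of the crossings of its boundary with the ray `{exp μ • x | μ > 0}`. -/
theorem Encloses.indicator_eq_sum [Fintype ι] {p : ι → Fin m → E} {w : ι → E} {R : Set E}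
    (h : Encloses p w R) (c : ι → ℝ) (hc : ∀ i a, inner ℝ (p i a) (w i) = c i)
    {x : E} (hx0 : x ≠ 0) (hx : ∀ i, x ∉ convexHull ℝ (Set.range (p i)))
    (hgen : ∀ i (μ : ℝ), Real.exp μ • x ∈ convexHull ℝ (Set.range (p i)) →
      Real.exp μ • x ∈ simplexInterior (p i) ∧ inner ℝ x (w i) ≠ 0) :
    R.indicator (fun _ => (1 : ℝ)) x =
      ∑ i, {y | ∃ μ > 0, Real.exp μ • y ∈ simplexInterior (p i)}.indicator
        (fun y => (SignType.sign (inner ℝ y (w i)) : ℝ)) x := by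
  classical
  set I : Finset ι := Finset.univ.filter
    fun i => ∃ μ : ℝ, Real.exp μ • x ∈ simplexInterior (p i) with hI
  have hIt : ∀ i, ∃ t : ℝ, i ∈ I → Real.exp t • x ∈ simplexInterior (p i) := by
    intro i
    by_cases hi : i ∈ I
    · obtain ⟨t, ht⟩ := (Finset.mem_filter.1 hi).2
      exact ⟨t, fun _ => ht⟩
    · exact ⟨0, fun h => absurd h hi⟩
  choose t ht using hIt
  have huniq : ∀ i ∈ I, ∀ μ : ℝ, Real.exp μ • x ∈ convexHull ℝ (Set.range (p i)) → μ = t i := by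
    intro i hi μ hμ
    have h1 := inner_eq_of_mem_convexHull (hc i) hμ
    have h2 := inner_eq_of_mem_convexHull (hc i) (simplexInterior_subset _ (ht i hi))
    have h3 := (hgen i μ hμ).2
    rw [inner_smul_left] at h1 h2
    have h4 := mul_right_cancel₀ h3 (h1.trans h2.symm)
    exact Real.exp_injective (by simpa using h4)
  have hmemI : ∀ i (μ : ℝ), Real.exp μ • x ∈ convexHull ℝ (Set.range (p i)) → i ∈ I :=
    fun i μ hμ => Finset.mem_filter.2 ⟨Finset.mem_univ _, μ, (hgen i μ hμ).1⟩
  have hcont : Continuous fun μ : ℝ => Real.exp μ • x := by fun_prop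
  -- parameterizing the ray by `exp μ` makes the whole line the domain and avoids the origin
  set f : ℝ → ℝ := fun μ => R.indicator (fun _ => (1 : ℝ)) (Real.exp μ • x) with hf
  set s : ι → ℝ := fun i => (SignType.sign (inner ℝ x (w i)) : ℝ) with hs
  have key := eq_sum_jumps I t s f ?_ ?_ ?_ ?_ 0 ?_
  · simp only [hf, Real.exp_zero, one_smul] at key
    rw [key, ← Finset.sum_filter_add_sum_filter_not Finset.univ
      (fun i => ∃ μ : ℝ, Real.exp μ • x ∈ simplexInterior (p i))]
    rw [Finset.sum_eq_zero (s := Finset.univ.filter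
      (fun i => ¬ ∃ μ : ℝ, Real.exp μ • x ∈ simplexInterior (p i))), add_zero]
    · refine Finset.sum_congr rfl fun i hi => ?_
      by_cases h0 : 0 < t i
      · have hxm : x ∈ {y | ∃ μ > 0, Real.exp μ • y ∈ simplexInterior (p i)} := ⟨t i, h0, ht i hi⟩
        rw [Set.indicator_of_mem hxm, if_pos h0, mul_one]
      · rw [Set.indicator_of_notMem, if_neg h0, mul_zero]
        rintro ⟨μ, hμ0, hμ⟩
        exact h0 (huniq i hi μ (simplexInterior_subset _ hμ) ▸ hμ0)
    · intro i hi
      rw [Set.indicator_of_notMem]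
      rintro ⟨μ, -, hμ⟩
      exact (Finset.mem_filter.1 hi).2 ⟨μ, hμ⟩
  · intro i hi j hj hij
    by_contra hne
    refine Set.disjoint_left.1 (h.disjoint i j hne) (ht i hi) ?_
    rw [hij]; exact ht j hj
  · intro μ hμ
    have hnot : ∀ i, Real.exp μ • x ∉ convexHull ℝ (Set.range (p i)) := fun i hi =>
      hμ i (hmemI i μ hi) (huniq i (hmemI i μ hi) μ hi).symm
    filter_upwards [hcont.continuousAt.eventually (h.eventually_mem_iff hnot)] with ν hν
    simp only [hf, Set.indicator_apply, hν]
  -- the region lies on one side of the crossing, according to the sign of `⟨x, w i⟩`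
  · intro i hi
    obtain ⟨ε, hε, hout⟩ := h.outer i _ (ht i hi)
    have hnear : ∀ᶠ μ in 𝓝[≠] (t i), dist (Real.exp μ • x) (Real.exp (t i) • x) < ε :=
      (hcont.continuousAt.eventually (Metric.ball_mem_nhds _ hε)).filter_mono nhdsWithin_le_nhds
    have hinner : ∀ μ, inner ℝ (Real.exp μ • x - Real.exp (t i) • x) (w i)
        = (Real.exp μ - Real.exp (t i)) * inner ℝ x (w i) := by
      intro μ
      rw [← sub_smul, inner_smul_left]; simp
    have hne := (hgen i _ (simplexInterior_subset _ (ht i hi))).2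
    rcases lt_or_gt_of_ne hne with hneg | hpos
    · refine ⟨1, ?_⟩
      filter_upwards [hnear, self_mem_nhdsWithin] with μ hμ hμt
      obtain ⟨h1, h2⟩ := hout _ hμ
      rw [hinner] at h1 h2
      simp only [hf, hs, sign_neg hneg]
      rcases lt_or_gt_of_ne hμt with hlt | hgt
      · have : Real.exp μ - Real.exp (t i) < 0 := sub_neg.2 (Real.exp_lt_exp.2 hlt)
        rw [Set.indicator_of_notMem (h2 (mul_pos_of_neg_of_neg this hneg)), if_pos hlt]; simp
      · have : 0 < Real.exp μ - Real.exp (t i) := sub_pos.2 (Real.exp_lt_exp.2 hgt)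
        rw [Set.indicator_of_mem (h1 (mul_neg_of_pos_of_neg this hneg)), if_neg hgt.not_gt]; simp
    · refine ⟨0, ?_⟩
      filter_upwards [hnear, self_mem_nhdsWithin] with μ hμ hμt
      obtain ⟨h1, h2⟩ := hout _ hμ
      rw [hinner] at h1 h2
      simp only [hf, hs, sign_pos hpos]
      rcases lt_or_gt_of_ne hμt with hlt | hgt
      · have : Real.exp μ - Real.exp (t i) < 0 := sub_neg.2 (Real.exp_lt_exp.2 hlt)
        rw [Set.indicator_of_mem (h1 (mul_neg_of_neg_of_pos this hpos)), if_pos hlt]; simp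
      · have : 0 < Real.exp μ - Real.exp (t i) := sub_pos.2 (Real.exp_lt_exp.2 hgt)
        rw [Set.indicator_of_notMem (h2 (mul_pos this hpos)), if_neg hgt.not_gt]; simp
  · obtain ⟨C, hC⟩ := h.bounded.exists_norm_le
    have h1 : Tendsto (fun μ : ℝ => Real.exp μ * ‖x‖) atTop atTop :=
      Real.tendsto_exp_atTop.atTop_mul_const (norm_pos_iff.2 hx0)
    filter_upwards [h1.eventually_gt_atTop C] with μ hμ
    simp only [hf]
    refine Set.indicator_of_notMem (fun hR => ?_) _
    have := hC _ hR
    rw [norm_smul, Real.norm_eq_abs, Real.abs_exp] at this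
    linarith
  · intro i hi h0
    have := simplexInterior_subset _ (ht i hi)
    rw [h0, Real.exp_zero, one_smul] at this
    exact hx i this

end Ray

section Volume

variable {k : ℕ} {ι : Type*}

/-- The determinant of `k + 1` vectors of `ℝ^(k+1)`. -/
noncomputable abbrev stdDet (k : ℕ) :
    EuclideanSpace ℝ (Fin (k + 1)) [⋀^Fin (k + 1)]→ₗ[ℝ] ℝ :=
  (EuclideanSpace.basisFun (Fin (k + 1)) ℝ).toBasis.det

/-- The open simplex spanned by the origin and the standard basis vectors of `ℝ^(k+1)`. -/
def corner (k : ℕ) : Set (EuclideanSpace ℝ (Fin (k + 1))) :=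
  {v | (∀ a, 0 < v a) ∧ ∑ a, v a < 1}

/-- The open cone from the origin over a simplex. -/
def openCone {E : Type*} [AddCommGroup E] [Module ℝ E] {m : ℕ} (p : Fin m → E) : Set E :=
  {x | ∃ w : Fin m → ℝ, (∀ a, 0 < w a) ∧ ∑ a, w a < 1 ∧ x = ∑ a, w a • p a}

theorem exists_exp_smul_mem_iff {E : Type*} [AddCommGroup E] [Module ℝ E]
    (p : Fin (k + 1) → E) (x : E) :
    (∃ μ > 0, Real.exp μ • x ∈ simplexInterior p) ↔ x ∈ openCone p := by
  constructor
  · rintro ⟨μ, hμ, w, h0, h1, hx⟩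
    refine ⟨fun a => Real.exp (-μ) * w a, fun a => mul_pos (Real.exp_pos _) (h0 a), ?_, ?_⟩
    · rw [← Finset.mul_sum, h1, mul_one]
      rw [← Real.exp_zero]; exact Real.exp_lt_exp.2 (by linarith)
    · simp_rw [mul_smul, ← Finset.smul_sum, ← hx, smul_smul, ← Real.exp_add]
      simp
  · rintro ⟨w, h0, h1, rfl⟩
    have hs : 0 < ∑ a, w a := Finset.sum_pos (fun a _ => h0 a) Finset.univ_nonempty
    refine ⟨-Real.log (∑ a, w a), neg_pos.2 (Real.log_neg hs h1),
      fun a => (∑ a, w a)⁻¹ * w a, fun a => mul_pos (inv_pos.2 hs) (h0 a), ?_, ?_⟩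
    · rw [← Finset.mul_sum, inv_mul_cancel₀ hs.ne']
    · rw [Real.exp_neg, Real.exp_log hs]
      simp_rw [mul_smul, ← Finset.smul_sum]

theorem openCone_eq_image (p : Fin (k + 1) → EuclideanSpace ℝ (Fin (k + 1))) :
    openCone p = Matrix.toLin (EuclideanSpace.basisFun (Fin (k + 1)) ℝ).toBasis
      (EuclideanSpace.basisFun (Fin (k + 1)) ℝ).toBasis
      ((EuclideanSpace.basisFun (Fin (k + 1)) ℝ).toBasis.toMatrix p) '' corner k := by
  set b := (EuclideanSpace.basisFun (Fin (k + 1)) ℝ).toBasis with hb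
  have hL : ∀ v : EuclideanSpace ℝ (Fin (k + 1)),
      Matrix.toLin b b (b.toMatrix p) v = ∑ a, v a • p a := by
    intro v
    conv_lhs => rw [← b.sum_repr v]
    rw [map_sum]
    refine Finset.sum_congr rfl fun a _ => ?_
    rw [map_smul, Matrix.toLin_self, Module.Basis.sum_toMatrix_smul_self]
    simp [hb]
  ext x
  constructor
  · rintro ⟨w, h0, h1, rfl⟩
    exact ⟨WithLp.toLp 2 w, ⟨h0, h1⟩, hL _⟩
  · rintro ⟨v, ⟨h0, h1⟩, rfl⟩
    exact ⟨v, h0, h1, hL v⟩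

theorem isBounded_corner (k : ℕ) : Bornology.IsBounded (corner k) := by
  rw [isBounded_iff_forall_norm_le]
  refine ⟨Real.sqrt (k + 1), fun v hv => ?_⟩
  rw [EuclideanSpace.norm_eq]
  refine Real.sqrt_le_sqrt ?_
  calc ∑ a, ‖v a‖ ^ 2 ≤ ∑ _a : Fin (k + 1), (1 : ℝ) := by
        refine Finset.sum_le_sum fun a _ => ?_
        have h1 : v a ≤ ∑ a, v a := Finset.single_le_sum (fun a _ => (hv.1 a).le) (Finset.mem_univ a)
        rw [Real.norm_eq_abs, sq_abs]
        have := hv.2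
        have := hv.1 a
        nlinarith
    _ = k + 1 := by simp

theorem isOpen_corner (k : ℕ) : IsOpen (corner k) := by
  have : corner k = (⋂ a, {v | 0 < v a}) ∩ {v | ∑ a, v a < 1} := by
    ext v; simp [corner]
  rw [this]
  refine IsOpen.inter (isOpen_iInter_of_finite fun a => ?_) ?_
  · exact isOpen_lt continuous_const (by fun_prop)
  · exact isOpen_lt (by fun_prop) continuous_const

theorem volume_openCone (p : Fin (k + 1) → EuclideanSpace ℝ (Fin (k + 1))) :
    volume.real (openCone p) = |stdDet k p| * volume.real (corner k) := by
  rw [openCone_eq_image, measureReal_def, Measure.addHaar_image_linearMap, LinearMap.det_toLin,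
    ENNReal.toReal_mul, ENNReal.toReal_ofReal (abs_nonneg _), measureReal_def, stdDet,
    Module.Basis.det_apply]

theorem measure_openCone_lt_top (p : Fin (k + 1) → EuclideanSpace ℝ (Fin (k + 1))) :
    volume (openCone p) < ⊤ := by
  rw [openCone_eq_image, Measure.addHaar_image_linearMap]
  exact ENNReal.mul_lt_top ENNReal.ofReal_lt_top (isBounded_corner k).measure_lt_top

theorem measurableSet_openCone {p : Fin (k + 1) → EuclideanSpace ℝ (Fin (k + 1))}
    (hp : stdDet k p ≠ 0) : MeasurableSet (openCone p) := by
  rw [openCone_eq_image]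
  set b := (EuclideanSpace.basisFun (Fin (k + 1)) ℝ).toBasis with hb
  have hdet : LinearMap.det (Matrix.toLin b b (b.toMatrix p)) ≠ 0 := by
    rw [LinearMap.det_toLin]; exact hp
  have := ((LinearMap.equivOfDetNeZero _ hdet).toContinuousLinearEquiv.toHomeomorph.isOpenMap
    _ (isOpen_corner k)).measurableSet
  exact this

theorem stdDet_eq_zero_iff (p : Fin (k + 1) → EuclideanSpace ℝ (Fin (k + 1))) :
    stdDet k p = 0 ↔ Submodule.span ℝ (Set.range p) ≠ ⊤ := by
  set b := (EuclideanSpace.basisFun (Fin (k + 1)) ℝ).toBasis with hb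
  have h := b.is_basis_iff_det (v := p)
  rw [isUnit_iff_ne_zero] at h
  constructor
  · intro h0 htop
    refine h.1 ⟨?_, htop⟩ h0
    exact linearIndependent_of_top_le_span_of_card_eq_finrank htop.ge (by simp)
  · intro hne
    by_contra h0
    exact hne (h.2 h0).2

/-- The points that are not in general position with respect to a simplex, as seen from the
origin: those in the linear span of a facet, in the affine span of the simplex, or, if it is
proper, in the linear span of the simplex. -/
def badSet (p : Fin (k + 1) → EuclideanSpace ℝ (Fin (k + 1))) :
    Set (EuclideanSpace ℝ (Fin (k + 1))) :=
  (⋃ a : Fin (k + 1), (Submodule.span ℝ (Set.range fun b : Fin k => p (a.succAbove b)) :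
      Set (EuclideanSpace ℝ (Fin (k + 1))))) ∪
    (affineSpan ℝ (Set.range p) : Set (EuclideanSpace ℝ (Fin (k + 1)))) ∪
    {x | stdDet k p = 0 ∧ x ∈ Submodule.span ℝ (Set.range p)}

theorem volume_badSet (p : Fin (k + 1) → EuclideanSpace ℝ (Fin (k + 1))) :
    volume (badSet p) = 0 := by
  refine measure_union_null (measure_union_null (measure_iUnion_null fun a => ?_) ?_) ?_
  · refine Measure.addHaar_submodule _ _ fun htop => ?_
    have h1 := finrank_range_le_card (R := ℝ) fun b : Fin k => p (a.succAbove b)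
    rw [Set.finrank, htop, finrank_top, finrank_euclideanSpace, Fintype.card_fin,
      Fintype.card_fin] at h1
    omega
  · refine Measure.addHaar_affineSubspace _ _ fun htop => ?_
    have h1 := finrank_vectorSpan_range_le ℝ p (n := k) (by simp)
    rw [← direction_affineSpan, htop, AffineSubspace.direction_top, finrank_top,
      finrank_euclideanSpace, Fintype.card_fin] at h1
    omega
  · by_cases h : stdDet k p = 0
    · refine measure_mono_null (fun x hx => hx.2)
        (Measure.addHaar_submodule _ _ ((stdDet_eq_zero_iff p).1 h))
    · simp [h]

/-- The **divergence theorem** for polyhedral regions: the volume of the region is, up to the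
volume of the standard simplex, the sum of `⟨p i 0, w i⟩`, where the normals `w i` are scaled
such that this is, up to sign, the determinant of the vertices. -/
theorem Encloses.volume_eq [Fintype ι] {p : ι → Fin (k + 1) → EuclideanSpace ℝ (Fin (k + 1))}
    {w : ι → EuclideanSpace ℝ (Fin (k + 1))} {R : Set (EuclideanSpace ℝ (Fin (k + 1)))}
    (h : Encloses p w R) (hc : ∀ i a, inner ℝ (p i a) (w i) = inner ℝ (p i 0) (w i))
    (hdet : ∀ i, |inner ℝ (p i 0) (w i)| = |stdDet k (p i)|) :
    volume.real R = volume.real (corner k) * ∑ i, inner ℝ (p i 0) (w i) := by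
  classical
  set c : ι → ℝ := fun i => inner ℝ (p i 0) (w i) with hcdef
  have hdet0 : ∀ i, c i = 0 ↔ stdDet k (p i) = 0 := fun i => by
    rw [← abs_eq_zero, hdet i, abs_eq_zero]
  have hcone : ∀ i, ∀ x ∈ openCone (p i), SignType.sign (inner ℝ x (w i)) = SignType.sign (c i) := by
    rintro i x ⟨v, h0, h1, rfl⟩
    have hs : 0 < ∑ a, v a := Finset.sum_pos (fun a _ => h0 a) Finset.univ_nonempty
    have : inner ℝ (∑ a, v a • p i a) (w i) = (∑ a, v a) * c i := by
      simp_rw [sum_inner, inner_smul_left, hc i, Finset.sum_mul]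
      rfl
    rw [this, sign_mul, sign_pos hs, one_mul]
  have hae : ∀ᵐ x ∂(volume : Measure (EuclideanSpace ℝ (Fin (k + 1)))),
      R.indicator (fun _ => (1 : ℝ)) x =
        ∑ i, (openCone (p i)).indicator (fun _ => (SignType.sign (c i) : ℝ)) x := by
    have hnull : volume ((⋃ i, badSet (p i)) ∪ {0}) = 0 :=
      measure_union_null (measure_iUnion_null fun i => volume_badSet (p i)) (measure_singleton _)
    filter_upwards [measure_eq_zero_iff_ae_notMem.1 hnull] with x hx
    simp only [Set.mem_union, Set.mem_iUnion, Set.mem_singleton_iff, not_or, not_exists] at hx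
    obtain ⟨hbad, hx0⟩ := hx
    rw [h.indicator_eq_sum c hc hx0]
    · refine Finset.sum_congr rfl fun i _ => ?_
      simp_rw [exists_exp_smul_mem_iff]
      by_cases hxi : x ∈ openCone (p i)
      · rw [Set.indicator_of_mem (by exact hxi), Set.indicator_of_mem hxi, hcone i x hxi]
      · rw [Set.indicator_of_notMem (by exact hxi), Set.indicator_of_notMem hxi]
    · intro i hi
      exact hbad i (Or.inl (Or.inr (convexHull_subset_affineSpan _ hi)))
    · intro i μ hμ
      have hin := inner_eq_of_mem_convexHull (hc i) hμ
      obtain ⟨v, h0, h1, hxv⟩ := exists_weights_of_mem_convexHull hμ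
      have hback : ∀ S : Submodule ℝ (EuclideanSpace ℝ (Fin (k + 1))), Real.exp μ • x ∈ S → x ∈ S :=
        fun S hS => (S.smul_mem_iff (Real.exp_ne_zero μ)).1 hS
      refine ⟨⟨v, fun a => lt_of_le_of_ne (h0 a) fun hva => ?_, h1, hxv⟩, fun h00 => ?_⟩
      · refine hbad i (Or.inl (Or.inl (Set.mem_iUnion.2 ⟨a, hback _ ?_⟩)))
        rw [hxv, Fin.sum_univ_succAbove _ a, ← hva, zero_smul, zero_add]
        exact Submodule.sum_mem _ fun b _ => Submodule.smul_mem _ _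
          (Submodule.subset_span ⟨b, rfl⟩)
      · refine hbad i (Or.inr ⟨(hdet0 i).1 ?_, hback _ ?_⟩)
        · rw [inner_smul_left, h00, mul_zero] at hin
          exact hin.symm
        · rw [hxv]
          exact Submodule.sum_mem _ fun b _ => Submodule.smul_mem _ _
            (Submodule.subset_span ⟨b, rfl⟩)
  rw [← integral_indicator_one h.isOpen.measurableSet]
  change ∫ x, R.indicator (fun _ => (1 : ℝ)) x = _
  rw [integral_congr_ae hae, integral_finsetSum]
  · rw [Finset.mul_sum]
    refine Finset.sum_congr rfl fun i _ => ?_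
    -- the cone over a simplex with dependent vertices gets the weight `0`
    by_cases h0 : c i = 0
    · simp only [h0, sign_zero, SignType.coe_zero, Set.indicator_zero, integral_zero]
      rw [show inner ℝ (p i 0) (w i) = 0 from h0, mul_zero]
    · rw [integral_indicator_const _ (measurableSet_openCone (mt (hdet0 i).2 h0)),
        volume_openCone, ← hdet i, smul_eq_mul, mul_comm |_|, mul_assoc, mul_comm |_|,
        sign_mul_abs]
  · intro i _
    by_cases h0 : c i = 0
    · simp [h0]
    · exact (integrable_indicator_iff (measurableSet_openCone (mt (hdet0 i).2 h0))).2
        (integrableOn_const (measure_openCone_lt_top _).ne)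

theorem volume_corner_zero : volume.real (corner 0) = 1 := by
  have h := (PiLp.volume_preserving_toLp (Fin 1)).measure_preimage
    (isOpen_corner 0).measurableSet.nullMeasurableSet
  have h2 : (WithLp.toLp 2 ⁻¹' corner 0 : Set (Fin 1 → ℝ))
      = Set.pi Set.univ fun _ => Set.Ioo 0 1 := by
    ext v
    simp [corner, Set.mem_pi, Fin.forall_fin_one]
  rw [measureReal_def, ← h, h2, volume_pi_pi]
  simp

theorem volume_corner_one : volume.real (corner 1) = 1 / 2 := by
  have h := (PiLp.volume_preserving_toLp (Fin 2)).measure_preimage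
    (isOpen_corner 1).measurableSet.nullMeasurableSet
  have h3 := (volume_preserving_finTwoArrow ℝ).symm.measure_preimage
    ((PiLp.volume_preserving_toLp (Fin 2)).measurable
      (isOpen_corner 1).measurableSet).nullMeasurableSet
  have h2 : ((MeasurableEquiv.finTwoArrow (α := ℝ)).symm ⁻¹'
      (WithLp.toLp 2 ⁻¹' corner 1 : Set (Fin 2 → ℝ)))
      = regionBetween (fun _ => 0) (fun x => 1 - x) (Set.Ioo 0 1) := by
    ext ⟨x, y⟩
    have h0 : ((MeasurableEquiv.finTwoArrow (α := ℝ)).symm (x, y) ∈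
        (WithLp.toLp 2 ⁻¹' corner 1 : Set (Fin 2 → ℝ))) ↔ (0 < x ∧ 0 < y) ∧ x + y < 1 :=
      and_congr Fin.forall_fin_two (by rw [Fin.sum_univ_two]; rfl)
    rw [Set.mem_preimage, h0]
    simp only [regionBetween, Set.mem_Ioo]
    constructor
    · rintro ⟨⟨h1, h2⟩, h3⟩; refine ⟨⟨h1, ?_⟩, h2, ?_⟩ <;> linarith
    · rintro ⟨⟨h1, h2⟩, h3, h4⟩; refine ⟨⟨h1, h3⟩, ?_⟩; linarith
  rw [measureReal_def, ← h, ← h3, h2]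
  have hcont : Continuous fun x : ℝ => 1 - x := by fun_prop
  rw [Measure.volume_eq_prod, volume_regionBetween_eq_integral
    (f := fun _ => (0 : ℝ)) (g := fun x => 1 - x)
    (integrableOn_const (by simp)) (hcont.integrableOn_Icc.mono_set
      Set.Ioo_subset_Icc_self) measurableSet_Ioo (fun x hx => by linarith [hx.2])]
  rw [← integral_Ioc_eq_integral_Ioo, ← intervalIntegral.integral_of_le zero_le_one]
  have hint : ∫ x in (0 : ℝ)..1, (1 - x) = 1 / 2 := by
    rw [intervalIntegral.integral_sub (by simp) (by simp)]
    simp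
    norm_num
  have hfun : ((fun x : ℝ => 1 - x) - fun _ => (0 : ℝ)) = fun x => 1 - x := by
    ext x; simp
  rw [hfun, hint, ENNReal.toReal_ofReal (by norm_num)]

end Volume

/-! ### Alternating forms on simplices -/

section Flux

variable {E : Type*} [NormedAddCommGroup E] [NormedSpace ℝ E] {m : ℕ}

/-- Replacing a vertex by `v` amounts, up to the sign of the facet, to prepending `v` to the opposite
facet. -/
theorem map_update_eq_facet (D : E [⋀^Fin (m + 1)]→ₗ[ℝ] ℝ) (p : Fin (m + 1) → E)
    (b : Fin (m + 1)) (v : E) :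
    D (Function.update p b v) = (-1) ^ (b : ℕ) * D (Fin.cons v (facet p b)) := by
  rw [← Fin.insertNth_removeNth, AlternatingMap.map_insertNth]
  simp only [zsmul_eq_mul, Int.cast_pow, Int.cast_neg, Int.cast_one,
    Int.reduceNeg]
  rfl

/-- Expansion of an alternating form in the edges of a simplex over the facets of the simplex. -/
theorem map_edges_eq_sum_facet (hm : m ≤ 2) (D : E [⋀^Fin m]→ₗ[ℝ] ℝ) (p : Fin (m + 1) → E) :
    D (fun b => p b.succ - p 0) = ∑ b : Fin (m + 1), (-1) ^ (b : ℕ) * D (facet p b) := by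
  have hsub : ∀ (v : Fin m → E) (i : Fin m) (x y : E), D (Function.update v i (x - y))
      = D (Function.update v i x) - D (Function.update v i y) := fun v i x y => D.map_update_sub v i x y
  interval_cases m
  · rw [Fin.sum_univ_succ, Subsingleton.elim (facet p 0) fun b : Fin 0 => p b.succ - p 0]
    simp
  · have h1 : ∀ x : E, (fun _ : Fin 1 => x) = Function.update (fun _ => 0) 0 x := by
      intro x; ext i; rw [Subsingleton.elim i 0]; simp
    have h2 : (fun b : Fin 1 => p b.succ - p 0) = fun _ => p 1 - p 0 := by
      ext i; rw [Subsingleton.elim i 0]; rfl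
    have h3 : facet p 0 = fun _ : Fin 1 => p 1 := by
      ext i; rw [Subsingleton.elim i 0]; rfl
    have h4 : facet p 1 = fun _ : Fin 1 => p 0 := by
      ext i; rw [Subsingleton.elim i 0]; rfl
    rw [Fin.sum_univ_two, h2, h3, h4, h1, hsub, ← h1, ← h1]
    simp [sub_eq_add_neg]
  · have h2 : (fun b : Fin 2 => p b.succ - p 0) = ![p 1 - p 0, p 2 - p 0] := by
      ext i; fin_cases i <;> rfl
    have h3 : facet p 0 = ![p 1, p 2] := by ext i; fin_cases i <;> rfl
    have h4 : facet p 1 = ![p 0, p 2] := by ext i; fin_cases i <;> rfl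
    have h5 : facet p 2 = ![p 0, p 1] := by ext i; fin_cases i <;> rfl
    have hA : ∀ x y z : E, D ![x - y, z] = D ![x, z] - D ![y, z] := by
      intro x y z
      have e : ∀ x : E, Function.update ![0, z] 0 x = ![x, z] := fun x => by
        ext i; fin_cases i <;> rfl
      simpa only [e] using hsub ![0, z] 0 x y
    have hB : ∀ x y z : E, D ![z, x - y] = D ![z, x] - D ![z, y] := by
      intro x y z
      have e : ∀ x : E, Function.update ![z, 0] 1 x = ![z, x] := fun x => by
        ext i; fin_cases i <;> rfl
      simpa only [e] using hsub ![z, 0] 1 x y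
    have hC : ∀ x : E, D ![x, x] = 0 := fun x =>
      D.map_eq_zero_of_eq ![x, x] (i := 0) (j := 1) rfl (by decide)
    have hS : D ![p 1, p 0] = - D ![p 0, p 1] := by
      have := D.map_swap ![p 0, p 1] (i := 0) (j := 1) (by decide)
      rw [← this]
      congr 1
      ext i; fin_cases i <;> rfl
    rw [Fin.sum_univ_three, h2, h3, h4, h5, hA, hB, hB, hC, hS]
    simp; ring

theorem map_cons_edges_eq_sum_facet (hm : m ≤ 2) (D : E [⋀^Fin (m + 1)]→ₗ[ℝ] ℝ)
    (p : Fin (m + 1) → E) (v : E) :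
    D (Fin.cons v fun b => p b.succ - p 0)
      = ∑ b : Fin (m + 1), (-1) ^ (b : ℕ) * D (Fin.cons v (facet p b)) :=
  map_edges_eq_sum_facet hm (D.curryLeft v) p

theorem map_cons_edges_eq_sum_update (hm : m ≤ 2) (D : E [⋀^Fin (m + 1)]→ₗ[ℝ] ℝ)
    (p : Fin (m + 1) → E) (v : E) :
    D (Fin.cons v fun b => p b.succ - p 0) = ∑ b, D (Function.update p b v) := by
  rw [map_cons_edges_eq_sum_facet hm]
  exact Finset.sum_congr rfl fun b _ => (map_update_eq_facet D p b v).symm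

/-- The value on the edges of a simplex, preceded by its vertex of index `0`, is the value on the
vertices. -/
theorem map_cons_zero_edges (hm : m ≤ 2) (D : E [⋀^Fin (m + 1)]→ₗ[ℝ] ℝ) (p : Fin (m + 1) → E) :
    D (Fin.cons (p 0) fun b => p b.succ - p 0) = D p := by
  rw [map_cons_edges_eq_sum_update hm, Finset.sum_eq_single 0]
  · rw [Function.update_eq_self]
  · intro b _ hb
    refine D.map_eq_zero_of_eq _ (i := b) (j := 0) ?_ hb
    rw [Function.update_self, Function.update_of_ne hb.symm]
  · simp

variable {V ι : Type*} [Fintype ι]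

/-- On a cycle, replacing the vertices of the simplices one at a time by a vertex field `δ` gives
the same as pairing the sum of the nodal values of `δ` with the edges: the difference is the value
on the boundary of the alternating cochain `f ↦ ∑ a, D (δ (f a), X (f 0), X (f 1), …)`. -/
theorem IsCycle.sum_cons_edges_eq {c : ι → ℤ} {s : ι → Fin (m + 1) → V} (h : 1 ≤ m → IsCycle c s)
    (hm : m ≤ 2) (D : E [⋀^Fin (m + 1)]→ₗ[ℝ] ℝ) (X δ : V → E) :
    ∑ i, (c i : ℝ) * ∑ a, D (Fin.cons (δ (s i a)) fun b => X (s i b.succ) - X (s i 0))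
      = ∑ i, (c i : ℝ) * ∑ a, D (Function.update (fun b => X (s i b)) a (δ (s i a))) := by
  set Φ : (Fin m → V) → ℝ := fun f => ∑ a, D (Fin.cons (δ (f a)) fun b => X (f b)) with hΦ
  have halt : IsAlternating Φ := by
    intro f π
    simp only [hΦ, Function.comp_apply]
    rw [Equiv.sum_comp π fun a' => D (Fin.cons (δ (f a')) fun b => X (f (π b))), Finset.mul_sum]
    refine Finset.sum_congr rfl fun a _ => ?_
    have := (D.curryLeft (δ (f a))).map_perm (fun b => X (f b)) π
    simp only [Units.smul_def, zsmul_eq_mul] at this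
    exact this
  have key : ∀ i, ∑ a, D (Fin.cons (δ (s i a)) fun b => X (s i b.succ) - X (s i 0))
      = ∑ a, D (Function.update (fun b => X (s i b)) a (δ (s i a)))
        + ∑ b : Fin (m + 1), (-1 : ℝ) ^ (b : ℕ) * Φ (facet (s i) b) := by
    intro i
    calc _ = ∑ b : Fin (m + 1), ∑ a : Fin (m + 1),
          (-1 : ℝ) ^ (b : ℕ) * D (Fin.cons (δ (s i a)) (facet (fun b => X (s i b)) b)) := by
          rw [Finset.sum_comm]
          refine Finset.sum_congr rfl fun a _ => ?_
          exact map_cons_edges_eq_sum_facet hm D (fun b => X (s i b)) _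
      _ = ∑ b : Fin (m + 1), ((-1 : ℝ) ^ (b : ℕ) *
            D (Fin.cons (δ (s i b)) (facet (fun b => X (s i b)) b)) +
            (-1 : ℝ) ^ (b : ℕ) * Φ (facet (s i) b)) := by
          refine Finset.sum_congr rfl fun b _ => ?_
          rw [Fin.sum_univ_succAbove _ b, hΦ, Finset.mul_sum]
          rfl
      _ = _ := by
          rw [Finset.sum_add_distrib]
          congr 1
          exact Finset.sum_congr rfl fun b _ => (map_update_eq_facet D _ b _).symm
  have hzero : ∑ i, (c i : ℝ) * ∑ b : Fin (m + 1), (-1 : ℝ) ^ (b : ℕ) * Φ (facet (s i) b) = 0 := by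
    rcases Nat.eq_zero_or_pos m with rfl | hpos
    · simp [hΦ]
    · exact h hpos Φ halt
  simp_rw [key, mul_add, Finset.sum_add_distrib]
  rw [hzero, add_zero]

/-- The straight line motion of a point. -/
noncomputable def segMotion (t₀ t₁ : ℝ) (x y : E) (t : ℝ) : E :=
  ((t₁ - t) / (t₁ - t₀)) • x + ((t - t₀) / (t₁ - t₀)) • y

theorem segMotion_left {t₀ t₁ : ℝ} (ht : t₀ < t₁) (x y : E) : segMotion t₀ t₁ x y t₀ = x := by
  simp [segMotion, div_self (sub_pos.2 ht).ne']

theorem segMotion_right {t₀ t₁ : ℝ} (ht : t₀ < t₁) (x y : E) : segMotion t₀ t₁ x y t₁ = y := by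
  simp [segMotion, div_self (sub_pos.2 ht).ne']

theorem hasDerivAt_segMotion (t₀ t₁ : ℝ) (x y : E) (t : ℝ) :
    HasDerivAt (segMotion t₀ t₁ x y) ((1 / (t₁ - t₀)) • (y - x)) t := by
  have h1 : HasDerivAt (fun t : ℝ => (t₁ - t) / (t₁ - t₀)) (-1 / (t₁ - t₀)) t :=
    ((hasDerivAt_id t).const_sub t₁).div_const _
  have h2 : HasDerivAt (fun t : ℝ => (t - t₀) / (t₁ - t₀)) (1 / (t₁ - t₀)) t :=
    ((hasDerivAt_id t).sub_const t₀).div_const _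
  convert! (h1.smul_const x).add (h2.smul_const y) using 1
  rw [smul_sub, neg_div, neg_smul]
  abel

theorem continuous_segMotion (t₀ t₁ : ℝ) (x y : E) : Continuous (segMotion t₀ t₁ x y) :=
  continuous_iff_continuousAt.2 fun t => (hasDerivAt_segMotion t₀ t₁ x y t).continuousAt

/-- The change of the algebraic volume `∑ i, c i * D (X (s i 0), …, X (s i m))` bounded by a moving
cycle is the time integral of the flux of the velocity. -/
theorem IsCycle.sum_sub_eq_integral {c : ι → ℤ} {s : ι → Fin (m + 1) → V} (h : 1 ≤ m → IsCycle c s)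
    (hm : m ≤ 2) (D : E [⋀^Fin (m + 1)]→ₗ[ℝ] ℝ) (hD : Continuous D) (X₀ X₁ : V → E)
    {t₀ t₁ : ℝ} (ht : t₀ < t₁) :
    ∑ i, (c i : ℝ) * D (fun a => X₁ (s i a)) - ∑ i, (c i : ℝ) * D (fun a => X₀ (s i a))
      = 1 / (t₁ - t₀) * ∑ i, (c i : ℝ) * ∑ a, ∫ t in t₀..t₁,
          D (Fin.cons (X₁ (s i a) - X₀ (s i a)) fun b =>
            segMotion t₀ t₁ (X₀ (s i b.succ)) (X₁ (s i b.succ)) t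
              - segMotion t₀ t₁ (X₀ (s i 0)) (X₁ (s i 0)) t) := by
  set Dc : ContinuousMultilinearMap ℝ (fun _ : Fin (m + 1) => E) ℝ :=
    { D.toMultilinearMap with cont := hD } with hDc
  have hDcD : ∀ v, Dc v = D v := fun v => rfl
  have hderiv : ∀ i t, HasDerivAt
      (fun t => D fun a => segMotion t₀ t₁ (X₀ (s i a)) (X₁ (s i a)) t)
      (∑ a, D (Function.update (fun a => segMotion t₀ t₁ (X₀ (s i a)) (X₁ (s i a)) t) a
        ((1 / (t₁ - t₀)) • (X₁ (s i a) - X₀ (s i a))))) t := by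
    intro i t
    have h1 : HasDerivAt (fun t => fun a => segMotion t₀ t₁ (X₀ (s i a)) (X₁ (s i a)) t)
        (fun a => (1 / (t₁ - t₀)) • (X₁ (s i a) - X₀ (s i a))) t :=
      hasDerivAt_pi.2 fun a => hasDerivAt_segMotion _ _ _ _ _
    have h2 := (Dc.hasFDerivAt (x := fun a => segMotion t₀ t₁ (X₀ (s i a)) (X₁ (s i a)) t)
      ).comp_hasDerivAt t h1
    refine HasDerivAt.congr_deriv (f := fun t => D fun a =>
      segMotion t₀ t₁ (X₀ (s i a)) (X₁ (s i a)) t) h2 ?_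
    rw [ContinuousMultilinearMap.linearDeriv_apply]
    rfl
  have hcont : ∀ i a, Continuous fun t => D (Fin.cons (X₁ (s i a) - X₀ (s i a)) fun b =>
            segMotion t₀ t₁ (X₀ (s i b.succ)) (X₁ (s i b.succ)) t
              - segMotion t₀ t₁ (X₀ (s i 0)) (X₁ (s i 0)) t) := by
    intro i a
    refine hD.comp (continuous_pi fun b => ?_)
    refine Fin.cases ?_ (fun b => ?_) b
    · exact continuous_const
    · exact (continuous_segMotion _ _ _ _).sub (continuous_segMotion _ _ _ _)
  have hsum : ∀ t, HasDerivAt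
      (fun t => ∑ i, (c i : ℝ) * D fun a => segMotion t₀ t₁ (X₀ (s i a)) (X₁ (s i a)) t)
      (1 / (t₁ - t₀) * ∑ i, (c i : ℝ) * ∑ a, D (Fin.cons (X₁ (s i a) - X₀ (s i a)) fun b =>
            segMotion t₀ t₁ (X₀ (s i b.succ)) (X₁ (s i b.succ)) t
              - segMotion t₀ t₁ (X₀ (s i 0)) (X₁ (s i 0)) t)) t := by
    intro t
    have h1 := HasDerivAt.fun_sum (u := Finset.univ) fun i _ => (hderiv i t).const_mul (c i : ℝ)
    refine h1.congr_deriv ?_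
    rw [IsCycle.sum_cons_edges_eq h hm D (fun v => segMotion t₀ t₁ (X₀ v) (X₁ v) t)
      (fun v => X₁ v - X₀ v), Finset.mul_sum]
    refine Finset.sum_congr rfl fun i _ => ?_
    rw [mul_left_comm, Finset.mul_sum _ _ (1 / (t₁ - t₀))]
    congr 1
    refine Finset.sum_congr rfl fun a _ => ?_
    rw [D.map_update_smul, smul_eq_mul]
  have hftc := intervalIntegral.integral_eq_sub_of_hasDerivAt (a := t₀) (b := t₁)
    (fun t _ => hsum t) (Continuous.intervalIntegrable (continuous_const.mul
      (continuous_finsetSum _ fun i _ => continuous_const.mul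
        (continuous_finsetSum _ fun a _ => hcont i a))) _ _)
  simp only [segMotion_left ht, segMotion_right ht] at hftc
  rw [← hftc, intervalIntegral.integral_const_mul, intervalIntegral.integral_finsetSum]
  · congr 1
    refine Finset.sum_congr rfl fun i _ => ?_
    rw [intervalIntegral.integral_const_mul, intervalIntegral.integral_finsetSum]
    exact fun a _ => (hcont i a).intervalIntegrable _ _
  · exact fun i _ => (continuous_const.mul
        (continuous_finsetSum _ fun a _ => hcont i a)).intervalIntegrable _ _

end Flux

/-! ### The wedge product and surface gradients -/

section Wedge
variable {n : ℕ}

theorem stdDet_apply {k : ℕ} (v : Fin (k + 1) → EuclideanSpace ℝ (Fin (k + 1))) :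
    stdDet k v = Matrix.det (Matrix.of fun i => (v i).ofLp) := by
  rw [Module.Basis.det_apply, ← Matrix.det_transpose]
  congr 1

theorem continuous_stdDet (k : ℕ) : Continuous (stdDet k) := by
  have : ⇑(stdDet k) = fun v => Matrix.det (Matrix.of fun i => (v i).ofLp) := by
    ext v; exact stdDet_apply v
  rw [this]
  refine Continuous.matrix_det ?_
  refine continuous_pi fun i => continuous_pi fun j => ?_
  simp only [Matrix.of_apply]
  fun_prop

theorem inner_wedge (w : Pt n) (v : Fin (n + 1) → Pt n) :
    inner ℝ w (wedge v) = stdDet (n + 1) (Fin.cons w v) := by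
  set b := EuclideanSpace.basisFun (Fin (n + 2)) ℝ with hb
  have hw : w = ∑ a, w a • b a := by
    conv_lhs => rw [← b.sum_repr w]
    simp [hb]
  have h1 : stdDet (n + 1) (Fin.cons w v)
      = ∑ a, w a * stdDet (n + 1) (Fin.cons (b a) v) := by
    have h0 : ∀ x : Pt n, stdDet (n + 1) (Fin.cons x v)
        = (stdDet (n + 1)).toMultilinearMap.toLinearMap (Fin.cons 0 v) 0 x := fun x => by
      rw [MultilinearMap.toLinearMap_apply, Fin.update_cons_zero]
      rfl
    simp_rw [h0]
    conv_lhs => rw [hw]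
    rw [map_sum]
    simp_rw [map_smul, smul_eq_mul]
  rw [h1, PiLp.inner_apply]
  refine Finset.sum_congr rfl fun a _ => ?_
  rw [stdDet_apply]
  simp only [wedge, RCLike.inner_apply, conj_trivial]
  rw [mul_comm]
  congr 2
  ext i j
  refine Fin.cases ?_ (fun i => ?_) i
  · simp [hb, Pi.single_apply]
  · simp

theorem inner_wedge_self (v : Fin (n + 1) → Pt n) (b : Fin (n + 1)) :
    inner ℝ (v b) (wedge v) = 0 := by
  rw [inner_wedge]
  refine (stdDet (n + 1)).map_eq_zero_of_eq _ (i := 0) (j := b.succ) ?_ (Fin.succ_ne_zero b).symm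
  simp

theorem linearIndependent_of_wedge_ne_zero {v : Fin (n + 1) → Pt n} (h : wedge v ≠ 0) :
    LinearIndependent ℝ v := by
  by_contra hli
  apply h
  rw [← inner_self_eq_zero (𝕜 := ℝ), inner_wedge]
  refine (stdDet (n + 1)).map_linearDependent _ fun hcons => hli ?_
  exact (linearIndependent_finCons.1 hcons).1

theorem span_eq_orthogonal_wedge {v : Fin (n + 1) → Pt n} (h : wedge v ≠ 0) :
    Submodule.span ℝ (Set.range v) = (Submodule.span ℝ {wedge v})ᗮ := by
  refine Submodule.eq_of_le_of_finrank_eq ?_ ?_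
  · rw [Submodule.span_le]
    rintro _ ⟨b, rfl⟩
    rw [SetLike.mem_coe, Submodule.mem_orthogonal_singleton_iff_inner_left]
    exact inner_wedge_self v b
  · rw [finrank_span_eq_card (linearIndependent_of_wedge_ne_zero h), Fintype.card_fin]
    have := Submodule.finrank_add_finrank_orthogonal (Submodule.span ℝ {wedge v})
    rw [finrank_span_singleton h, finrank_euclideanSpace, Fintype.card_fin] at this
    omega

theorem exists_coeff_of_inner_wedge_eq_zero {v : Fin (n + 1) → Pt n} (h : wedge v ≠ 0) {t : Pt n}
    (ht : inner ℝ t (wedge v) = 0) : ∃ c : Fin (n + 1) → ℝ, t = ∑ b, c b • v b := by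
  have : t ∈ Submodule.span ℝ (Set.range v) := by
    rw [span_eq_orthogonal_wedge h, Submodule.mem_orthogonal_singleton_iff_inner_left]
    exact ht
  obtain ⟨c, hc⟩ := (Submodule.mem_span_range_iff_exists_fun ℝ).1 this
  exact ⟨c, hc.symm⟩

/-- The defining property of the surface gradient on a nondegenerate simplex. -/
theorem inner_surfGrad {p : Fin (n + 2) → Pt n} (h : orient p ≠ 0) (f : Fin (n + 2) → ℝ)
    (c : Fin (n + 1)) : inner ℝ (surfGrad p f) (edges p c) = f c.succ - f 0 := by
  have hdet : (Matrix.gram ℝ (edges p)).det ≠ 0 :=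
    Matrix.det_gram_ne_zero_iff_linearIndependent.2 (linearIndependent_of_wedge_ne_zero h)
  have hinv : (Matrix.gram ℝ (edges p))⁻¹ * Matrix.gram ℝ (edges p) = 1 :=
    Matrix.nonsing_inv_mul _ (isUnit_iff_ne_zero.2 hdet)
  rw [surfGrad, sum_inner]
  calc _ = ∑ a, (f a.succ - f 0) *
        ((Matrix.gram ℝ (edges p))⁻¹ * Matrix.gram ℝ (edges p)) a c := by
        refine Finset.sum_congr rfl fun a _ => ?_
        rw [sum_inner, Matrix.mul_apply, Finset.mul_sum]
        refine Finset.sum_congr rfl fun b _ => ?_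
        rw [inner_smul_left, Matrix.gram_apply]
        simp only [conj_trivial]
        ring
    _ = _ := by
        rw [hinv]
        simp [Matrix.one_apply]

/-- In the direction `∑ b, c b • (p (b + 1) - p 0)` the derivative of an affine field is given by
the differences of its nodal values. -/
theorem dirDeriv_sum {p : Fin (n + 2) → Pt n} (h : orient p ≠ 0) (η : Fin (n + 2) → Pt n)
    (c : Fin (n + 1) → ℝ) :
    dirDeriv p η (∑ b, c b • edges p b) = ∑ b, c b • edges η b := by
  ext i
  simp only [dirDeriv, inner_sum, inner_smul_right, inner_surfGrad h]
  simp [edges]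

end Wedge
/-! ### The anisotropic surface energy -/

section Aniso
variable {n : ℕ}
open Matrix

/-- The determinant of a matrix with a first row that vanishes off the diagonal. -/
theorem det_of_first_row {m : ℕ} (A : Matrix (Fin (m + 1)) (Fin (m + 1)) ℝ)
    (h : ∀ b : Fin m, A 0 b.succ = 0) :
    A.det = A 0 0 * (Matrix.of fun a b : Fin m => A a.succ b.succ).det := by
  rw [det_succ_row_zero, Fin.sum_univ_succ]
  simp only [h, Fin.val_zero, pow_zero, one_mul, mul_zero, zero_mul, Finset.sum_const_zero,
    add_zero]
  rfl

/-- For a positive definite `G` the Gram determinant of `d - 1` vectors with respect to `G⁻¹`,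
multiplied by `det G`, is the value at their wedge product of the quadratic form of `G`. -/
theorem det_gram_inv (G : Matrix (Fin (n + 2)) (Fin (n + 2)) ℝ) (hG : G.PosDef)
    (v : Fin (n + 1) → Pt n) (hv : wedge v ≠ 0) :
    G.det * (Matrix.of fun a b => (v a).ofLp ⬝ᵥ G⁻¹ *ᵥ (v b).ofLp).det
      = (wedge v).ofLp ⬝ᵥ G *ᵥ (wedge v).ofLp := by
  have hdet : 0 < G.det := hG.det_pos
  have hunit : IsUnit G.det := isUnit_iff_ne_zero.2 hdet.ne'
  have hsymm : Gᵀ = G := by simpa using hG.isHermitian.eq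
  have hsymm' : G⁻¹ᵀ = G⁻¹ := by rw [transpose_nonsing_inv, hsymm]
  set w := wedge v with hw
  set q := w.ofLp ⬝ᵥ G *ᵥ w.ofLp with hq
  have hq0 : 0 < q := by
    have := hG.dotProduct_mulVec_pos (x := w.ofLp) (by simpa using hv)
    simpa using this
  set u : Fin (n + 2) → Fin (n + 2) → ℝ := Fin.cons (G *ᵥ w.ofLp) fun b => (v b).ofLp with hu
  -- `G w` is `G⁻¹`-orthogonal to the vectors `v b`, and its determinant with them is `⟨w, G w⟩`
  set A : Matrix (Fin (n + 2)) (Fin (n + 2)) ℝ := of u * G⁻¹ * (of u)ᵀ with hA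
  have hAab : ∀ a b, A a b = u a ⬝ᵥ G⁻¹ *ᵥ u b := by
    intro a b
    rw [hA, Matrix.mul_assoc, Matrix.mul_apply]
    rfl
  have hinvG : G⁻¹ *ᵥ (G *ᵥ w.ofLp) = w.ofLp := by
    rw [mulVec_mulVec, nonsing_inv_mul _ hunit, one_mulVec]
  have hsw : ∀ x y : Fin (n + 2) → ℝ, x ⬝ᵥ G⁻¹ *ᵥ y = y ⬝ᵥ G⁻¹ *ᵥ x := by
    intro x y
    rw [dotProduct_mulVec, ← mulVec_transpose, hsymm', dotProduct_comm]
  have hvw : ∀ b, (v b).ofLp ⬝ᵥ w.ofLp = 0 := by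
    intro b
    have := inner_wedge_self v b
    rw [EuclideanSpace.inner_eq_star_dotProduct] at this
    rw [dotProduct_comm]
    simpa using this
  have h00 : A 0 0 = q := by
    rw [hAab, hu, Fin.cons_zero, hinvG, dotProduct_comm]
  have h0b : ∀ b : Fin (n + 1), A 0 b.succ = 0 := by
    intro b
    rw [hAab, hsw, hu, Fin.cons_zero, Fin.cons_succ, hinvG, hvw]
  have hdu : (of u).det = q := by
    have h1 := inner_wedge (WithLp.toLp 2 (G *ᵥ w.ofLp)) v
    rw [stdDet_apply] at h1
    have h2 : (of fun i => ((Fin.cons (WithLp.toLp 2 (G *ᵥ w.ofLp)) v : Fin (n + 2) → Pt n) i).ofLp)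
        = of u := by
      ext i j
      refine Fin.cases ?_ (fun i => ?_) i <;> simp [hu]
    rw [h2] at h1
    rw [← h1, EuclideanSpace.inner_eq_star_dotProduct, hq]
    simp [hw]
  have h1 := det_of_first_row A h0b
  rw [hA, det_mul, det_mul, det_transpose, hdu, det_nonsing_inv, Ring.inverse_eq_inv', ← hA, h00] at h1
  have h2 : (Matrix.of fun a b : Fin (n + 1) => A a.succ b.succ)
      = Matrix.of fun a b => (v a).ofLp ⬝ᵥ G⁻¹ *ᵥ (v b).ofLp := by
    ext a b
    simp only [of_apply, hAab, hu, Fin.cons_succ]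
  rw [h2] at h1
  have h3 : q * G.det⁻¹ = (Matrix.of fun a b => (v a).ofLp ⬝ᵥ G⁻¹ *ᵥ (v b).ofLp).det :=
    mul_left_cancel₀ hq0.ne' (by rw [← h1]; ring)
  rw [← h3]
  field_simp

/-- Hölder's inequality in the form of a convexity inequality for the `ℓ^r`-norm: the weights are
the derivatives of the norm at `g`. -/
theorem lp_sub_le_sum {L : ℕ} {r : ℝ} (hr : 1 ≤ r) (g h : Fin L → ℝ) (hg : ∀ ℓ, 0 ≤ g ℓ)
    (hh : ∀ ℓ, 0 ≤ h ℓ) :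
    (∑ ℓ, g ℓ ^ r) ^ (1 / r) - (∑ ℓ, h ℓ ^ r) ^ (1 / r)
      ≤ ∑ ℓ, (g ℓ / (∑ ℓ, g ℓ ^ r) ^ (1 / r)) ^ (r - 1) * (g ℓ - h ℓ) := by
  have hr0 : 0 < r := by linarith
  have hS : 0 ≤ ∑ ℓ, g ℓ ^ r := Finset.sum_nonneg fun ℓ _ => Real.rpow_nonneg (hg ℓ) r
  have hT : 0 ≤ ∑ ℓ, h ℓ ^ r := Finset.sum_nonneg fun ℓ _ => Real.rpow_nonneg (hh ℓ) r
  set G := (∑ ℓ, g ℓ ^ r) ^ (1 / r) with hGdef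
  set H := (∑ ℓ, h ℓ ^ r) ^ (1 / r) with hHdef
  have hG0 : 0 ≤ G := Real.rpow_nonneg hS _
  have hH0 : 0 ≤ H := Real.rpow_nonneg hT _
  rcases hr.eq_or_lt with rfl | hr1
  · simp [hGdef, hHdef, Finset.sum_sub_distrib]
  have hGr : G ^ r = ∑ ℓ, g ℓ ^ r := by
    rw [hGdef, ← Real.rpow_mul hS, one_div_mul_cancel hr0.ne', Real.rpow_one]
  -- for `G = 0` the weights are junk values, but they vanish since `r > 1`
  rcases hG0.eq_or_lt with hG | hG
  · have : ∀ ℓ, (g ℓ / G) ^ (r - 1) = 0 := fun ℓ => by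
      rw [← hG, div_zero, Real.zero_rpow (by linarith)]
    simp only [this, zero_mul, Finset.sum_const_zero]
    linarith
  set c : Fin L → ℝ := fun ℓ => g ℓ / G with hc
  have hc0 : ∀ ℓ, 0 ≤ c ℓ := fun ℓ => div_nonneg (hg ℓ) hG.le
  have hcr : ∑ ℓ, c ℓ ^ r = 1 := by
    simp_rw [hc, Real.div_rpow (hg _) hG.le, ← Finset.sum_div, ← hGr]
    exact div_self (Real.rpow_pos_of_pos hG r).ne'
  have h1 : ∑ ℓ, c ℓ ^ (r - 1) * g ℓ = G := by
    have : ∀ ℓ, c ℓ ^ (r - 1) * g ℓ = G * c ℓ ^ r := by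
      intro ℓ
      have hgl : g ℓ = G * c ℓ := by rw [hc]; field_simp
      rw [hgl, mul_left_comm]
      congr 1
      conv_rhs => rw [show r = (r - 1) + 1 by ring]
      rw [Real.rpow_add_one' (hc0 ℓ) (by linarith)]
    simp_rw [this, ← Finset.mul_sum, hcr, mul_one]
  have h2 : ∑ ℓ, c ℓ ^ (r - 1) * h ℓ ≤ H := by
    have hpq : (r / (r - 1)).HolderConjugate r :=
      (Real.HolderConjugate.conjExponent hr1).symm
    have := Real.inner_le_Lp_mul_Lq_of_nonneg Finset.univ hpq
      (fun ℓ _ => Real.rpow_nonneg (hc0 ℓ) (r - 1)) (fun ℓ _ => hh ℓ)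
    refine this.trans ?_
    have h3 : ∀ ℓ, (c ℓ ^ (r - 1)) ^ (r / (r - 1)) = c ℓ ^ r := fun ℓ => by
      rw [← Real.rpow_mul (hc0 ℓ), mul_div_cancel₀ _ (by linarith)]
    simp_rw [h3, hcr, Real.one_rpow, one_mul]
    rfl
  simp_rw [mul_sub, Finset.sum_sub_distrib]
  linarith

namespace Anisotropy

variable (γ : Anisotropy n) (ℓ : Fin γ.L)

theorem component_nonneg (p : Pt n) : 0 ≤ γ.component ℓ p := Real.sqrt_nonneg _

theorem component_sq (p : Pt n) : γ.component ℓ p ^ 2 = p.ofLp ⬝ᵥ γ.G ℓ *ᵥ p.ofLp := by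
  refine Real.sq_sqrt ?_
  simpa using (γ.posDef ℓ).posSemidef.dotProduct_mulVec_nonneg p.ofLp

theorem component_smul {s : ℝ} (hs : 0 ≤ s) (p : Pt n) :
    γ.component ℓ (s • p) = s * γ.component ℓ p := by
  rw [component, component, WithLp.ofLp_smul, mulVec_smul, smul_dotProduct, dotProduct_smul,
    smul_eq_mul, smul_eq_mul, ← mul_assoc, Real.sqrt_mul (mul_nonneg hs hs), Real.sqrt_mul_self hs]

theorem component_pos {p : Pt n} (hp : p ≠ 0) : 0 < γ.component ℓ p := by
  refine Real.sqrt_pos.2 ?_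
  simpa using (γ.posDef ℓ).dotProduct_mulVec_pos (x := p.ofLp) (by simpa using hp)

theorem density_smul {s : ℝ} (hs : 0 ≤ s) (p : Pt n) :
    γ.density (s • p) = s * γ.density p := by
  have hr : 0 < γ.r := by linarith [γ.one_le_r]
  simp_rw [density, component_smul γ _ hs, Real.mul_rpow hs (component_nonneg γ _ p),
    ← Finset.mul_sum]
  rw [Real.mul_rpow (Real.rpow_nonneg hs _)
    (Finset.sum_nonneg fun ℓ _ => Real.rpow_nonneg (component_nonneg γ ℓ p) _),
    ← Real.rpow_mul hs, mul_one_div_cancel hr.ne', Real.rpow_one]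

/-- The matrix `G̃_ℓ`. -/
noncomputable def dualMatrix : Matrix (Fin (n + 2)) (Fin (n + 2)) ℝ :=
  ((γ.G ℓ).det ^ (1 / ((n : ℝ) + 1))) • (γ.G ℓ)⁻¹

theorem posDef_dualMatrix : (γ.dualMatrix ℓ).PosDef :=
  (γ.posDef ℓ).inv.smul (Real.rpow_pos_of_pos (γ.posDef ℓ).det_pos _)

theorem dualInner_comm (x y : Pt n) : γ.dualInner ℓ x y = γ.dualInner ℓ y x := by
  have hsymm : (γ.dualMatrix ℓ)ᵀ = γ.dualMatrix ℓ := by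
    simpa using (γ.posDef_dualMatrix ℓ).isHermitian.eq
  change x.ofLp ⬝ᵥ γ.dualMatrix ℓ *ᵥ y.ofLp = y.ofLp ⬝ᵥ γ.dualMatrix ℓ *ᵥ x.ofLp
  rw [dotProduct_mulVec, ← mulVec_transpose, hsymm, dotProduct_comm]

theorem dualInner_self_nonneg (x : Pt n) : 0 ≤ γ.dualInner ℓ x x := by
  change 0 ≤ x.ofLp ⬝ᵥ γ.dualMatrix ℓ *ᵥ x.ofLp
  simpa using (γ.posDef_dualMatrix ℓ).posSemidef.dotProduct_mulVec_nonneg x.ofLp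

theorem dualInner_sub_right (x y z : Pt n) :
    γ.dualInner ℓ x (y - z) = γ.dualInner ℓ x y - γ.dualInner ℓ x z := by
  simp only [dualInner, WithLp.ofLp_sub, mulVec_sub, dotProduct_sub]

theorem dualInner_sub_left (x y z : Pt n) :
    γ.dualInner ℓ (y - z) x = γ.dualInner ℓ y x - γ.dualInner ℓ z x := by
  simp only [dualInner, WithLp.ofLp_sub, sub_dotProduct]

/-- The `G̃_ℓ`-Gram matrix. -/
noncomputable def dualGram (v : Fin (n + 1) → Pt n) : Matrix (Fin (n + 1)) (Fin (n + 1)) ℝ :=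
  Matrix.of fun a b => γ.dualInner ℓ (v a) (v b)

/-- The scaling of `G̃_ℓ` is chosen such that `γ_ℓ` of the wedge product of `d - 1` vectors is their
`G̃_ℓ`-volume. -/
theorem det_dualGram {v : Fin (n + 1) → Pt n} (hv : wedge v ≠ 0) :
    (γ.dualGram ℓ v).det = γ.component ℓ (wedge v) ^ 2 := by
  have hpos := (γ.posDef ℓ).det_pos
  have h1 : γ.dualGram ℓ v = ((γ.G ℓ).det ^ (1 / ((n : ℝ) + 1))) •
      Matrix.of fun a b => (v a).ofLp ⬝ᵥ (γ.G ℓ)⁻¹ *ᵥ (v b).ofLp := by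
    ext a b
    simp [dualGram, dualInner, smul_mulVec, dotProduct_smul]
  have h2 : ((γ.G ℓ).det ^ (1 / ((n : ℝ) + 1))) ^ (n + 1) = (γ.G ℓ).det := by
    rw [← Real.rpow_natCast, ← Real.rpow_mul hpos.le]
    push_cast
    rw [one_div_mul_cancel (by positivity), Real.rpow_one]
  rw [component_sq, ← det_gram_inv _ (γ.posDef ℓ) v hv, h1, det_smul, Fintype.card_fin, h2]

theorem dualGram_sum (v : Fin (n + 1) → Pt n) (T : Matrix (Fin (n + 1)) (Fin (n + 1)) ℝ) :
    γ.dualGram ℓ (fun a => ∑ b, T a b • v b) = T * γ.dualGram ℓ v * Tᵀ := by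
  have hsum : ∀ c : Fin (n + 1) → ℝ, (∑ b, c b • v b).ofLp = ∑ b, c b • (v b).ofLp := by
    intro c
    ext i; simp
  ext a b
  simp only [dualGram, dualInner, of_apply, hsum, mulVec_sum, dotProduct_sum, sum_dotProduct,
    mulVec_smul, smul_dotProduct, dotProduct_smul, smul_eq_mul, Matrix.mul_apply, transpose_apply]
  refine Finset.sum_congr rfl fun d _ => ?_
  rw [Finset.mul_sum, Finset.sum_mul]
  refine Finset.sum_congr rfl fun c _ => ?_
  ring

/-- The arithmetic-geometric mean inequality for the Gram matrix of at most two vectors. -/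
theorem sub_one_le_of_sq_eq_det (hn : n ≤ 1) (y : Fin (n + 1) → Pt n) {q : ℝ}
    (hq : q = 0 ∨ (γ.dualGram ℓ y).det = q ^ 2) :
    q - 1 ≤ 1 / 2 * ∑ a, γ.dualInner ℓ (y a) (y a) - (n + 1) / 2 := by
  have hpos := fun a => γ.dualInner_self_nonneg ℓ (y a)
  rcases hq with rfl | hq
  · have h1 : 0 ≤ ∑ a, γ.dualInner ℓ (y a) (y a) := Finset.sum_nonneg fun a _ => hpos a
    have h2 : (n : ℝ) ≤ 1 := by exact_mod_cast hn
    linarith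
  · interval_cases n
    · rw [det_fin_one] at hq
      simp only [dualGram, of_apply] at hq
      rw [Fin.sum_univ_succ]
      simp only [Finset.univ_eq_empty, Finset.sum_empty, add_zero]
      push_cast
      nlinarith [sq_nonneg (q - 1)]
    · rw [det_fin_two] at hq
      simp only [dualGram, of_apply] at hq
      rw [γ.dualInner_comm ℓ (y 1) (y 0)] at hq
      rw [Fin.sum_univ_two]
      push_cast
      have h0 := hpos 0
      have h1 := hpos 1
      have h3 : q ^ 2 ≤ ((γ.dualInner ℓ (y 0) (y 0) + γ.dualInner ℓ (y 1) (y 1)) / 2) ^ 2 := by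
        nlinarith [sq_nonneg (γ.dualInner ℓ (y 0) (y 0) - γ.dualInner ℓ (y 1) (y 1)),
          sq_nonneg (γ.dualInner ℓ (y 0) (y 1))]
      have h4 := abs_le_of_sq_le_sq h3 (by linarith)
      linarith [le_abs_self q]

/-- The energy inequality on one simplex for one `γ_ℓ`. -/
theorem component_sub_le (hn : n ≤ 1) {p₀ p₁ : Fin (n + 2) → Pt n} (h₀ : orient p₀ ≠ 0)
    {t : Fin (n + 1) → Pt n} (ht : ∀ a, inner ℝ (t a) (unitNormal p₀) = 0)
    (hort : ∀ a b, γ.dualInner ℓ (t a) (t b) = if a = b then 1 else 0) :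
    γ.component ℓ (orient p₁) - γ.component ℓ (orient p₀)
      ≤ (∑ a, γ.dualInner ℓ (dirDeriv p₀ p₁ (t a)) (dirDeriv p₀ (fun b => p₁ b - p₀ b) (t a)))
        * γ.component ℓ (orient p₀) := by
  have hnorm : ‖orient p₀‖⁻¹ ≠ 0 := inv_ne_zero (norm_ne_zero_iff.2 h₀)
  have hc : ∀ a, ∃ c : Fin (n + 1) → ℝ, t a = ∑ b, c b • edges p₀ b := by
    intro a
    refine exists_coeff_of_inner_wedge_eq_zero h₀ ?_
    have := ht a
    rw [unitNormal, inner_smul_right] at this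
    exact (mul_eq_zero.1 this).resolve_left hnorm
  choose c hc using hc
  set T : Matrix (Fin (n + 1)) (Fin (n + 1)) ℝ := Matrix.of c with hT
  set y : Fin (n + 1) → Pt n := fun a => ∑ b, T a b • edges p₁ b with hy
  have hy1 : ∀ a, dirDeriv p₀ p₁ (t a) = y a := fun a => by
    rw [hc a, dirDeriv_sum h₀]; rfl
  have hy2 : ∀ a, dirDeriv p₀ (fun b => p₁ b - p₀ b) (t a) = y a - t a := fun a => by
    rw [hc a, dirDeriv_sum h₀, hy, ← Finset.sum_sub_distrib]
    refine Finset.sum_congr rfl fun b _ => ?_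
    rw [hT, of_apply, ← smul_sub]
    congr 1
    simp only [edges]
    abel
  have hg0 : 0 < γ.component ℓ (orient p₀) := γ.component_pos ℓ h₀
  set q := γ.component ℓ (orient p₁) / γ.component ℓ (orient p₀) with hqdef
  -- the change of basis from `t` to the edges has determinant `± 1 / γ_ℓ (orient p₀)`; the case
  -- `q = 0` is that of a degenerate new simplex
  have hq : q = 0 ∨ (γ.dualGram ℓ y).det = q ^ 2 := by
    by_cases h₁ : orient p₁ = 0
    · left
      rw [hqdef, h₁]
      simp [component]
    · right
      have e1 : T.det * (γ.dualGram ℓ (edges p₀)).det * T.det = 1 := by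
        have : γ.dualGram ℓ t = 1 := by
          ext a b
          simp [dualGram, hort, Matrix.one_apply]
        have h2 : t = fun a => ∑ b, T a b • edges p₀ b := funext hc
        rw [h2, dualGram_sum] at this
        have h3 := congrArg Matrix.det this
        rwa [det_mul, det_mul, det_transpose, det_one] at h3
      have e2 : (γ.dualGram ℓ y).det = T.det * (γ.dualGram ℓ (edges p₁)).det * T.det := by
        rw [hy, dualGram_sum, det_mul, det_mul, det_transpose]
      rw [det_dualGram γ ℓ h₀] at e1
      rw [det_dualGram γ ℓ h₁] at e2
      change T.det * γ.component ℓ (orient p₀) ^ 2 * T.det = 1 at e1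
      change _ = T.det * γ.component ℓ (orient p₁) ^ 2 * T.det at e2
      rw [e2, hqdef, div_pow, eq_div_iff (pow_ne_zero 2 hg0.ne')]
      linear_combination γ.component ℓ (orient p₁) ^ 2 * e1
  have hamgm := γ.sub_one_le_of_sq_eq_det ℓ hn y hq
  have hsum : 1 / 2 * ∑ a, γ.dualInner ℓ (y a) (y a) - (n + 1) / 2
      ≤ ∑ a, γ.dualInner ℓ (y a) (y a - t a) := by
    have hcard : ((n : ℝ) + 1) / 2 = ∑ a : Fin (n + 1), 1 / 2 * γ.dualInner ℓ (t a) (t a) := by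
      simp [hort]; ring
    rw [hcard, Finset.mul_sum, ← Finset.sum_sub_distrib]
    refine Finset.sum_le_sum fun a _ => ?_
    have h1 := γ.dualInner_self_nonneg ℓ (y a - t a)
    rw [dualInner_sub_right, dualInner_sub_left, dualInner_sub_left,
      γ.dualInner_comm ℓ (t a) (y a)] at h1
    rw [dualInner_sub_right]
    linarith
  simp_rw [hy1, hy2]
  calc _ = (q - 1) * γ.component ℓ (orient p₀) := by
        rw [hqdef, sub_mul, div_mul_cancel₀ _ hg0.ne', one_mul]
    _ ≤ _ := mul_le_mul_of_nonneg_right (hamgm.trans hsum) hg0.le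

theorem area_mul_component (p : Fin (n + 2) → Pt n) :
    area p * γ.component ℓ (unitNormal p) = γ.component ℓ (orient p) / (n + 1).factorial := by
  rw [area, unitNormal, component_smul γ ℓ (by positivity)]
  by_cases h : orient p = 0
  · simp [h, component]
  · field_simp [norm_ne_zero_iff.2 h]

theorem area_mul_density (p : Fin (n + 2) → Pt n) :
    area p * γ.density (unitNormal p) = γ.density (orient p) / (n + 1).factorial := by
  have hr : 0 < γ.r := by linarith [γ.one_le_r]
  rw [area, unitNormal, density_smul γ (by positivity)]
  by_cases h : orient p = 0
  · simp [h, density, component, Real.zero_rpow hr.ne', hr.ne']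
  · field_simp [norm_ne_zero_iff.2 h]

theorem component_div_density_unitNormal (p : Fin (n + 2) → Pt n) :
    γ.component ℓ (unitNormal p) / γ.density (unitNormal p)
      = γ.component ℓ (orient p) / γ.density (orient p) := by
  by_cases h : orient p = 0
  · simp [unitNormal, h]
  · rw [unitNormal, component_smul γ ℓ (by positivity), density_smul γ (by positivity),
      mul_div_mul_left _ _ (inv_ne_zero (norm_ne_zero_iff.2 h))]

/-- The change of the surface energy is bounded by the form at the displacement. -/
theorem surfaceEnergy_sub_le_form (hn : n ≤ 1) (M : Cluster n) (X₀ X₁ : Fin M.nV → Pt n)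
    (hX₀ : ∀ j, orient (M.pos X₀ j) ≠ 0) (t : Fin M.nJ → Fin γ.L → Fin (n + 1) → Pt n)
    (ht : γ.IsFrame M X₀ t) :
    γ.surfaceEnergy M X₁ - γ.surfaceEnergy M X₀
      ≤ γ.form M X₀ X₁ t X₁ fun v => X₁ v - X₀ v := by
  rw [surfaceEnergy, surfaceEnergy, form, ← Finset.sum_sub_distrib]
  refine Finset.sum_le_sum fun j _ => ?_
  have hfac : (0 : ℝ) < (n + 1).factorial := by positivity
  rw [area_mul_density, area_mul_density, Finset.mul_sum, ← sub_div]
  have h1 := lp_sub_le_sum γ.one_le_r (fun ℓ => γ.component ℓ (orient (M.pos X₁ j)))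
    (fun ℓ => γ.component ℓ (orient (M.pos X₀ j))) (fun ℓ => γ.component_nonneg ℓ _)
    (fun ℓ => γ.component_nonneg ℓ _)
  refine (div_le_div_of_nonneg_right h1 hfac.le).trans ?_
  rw [Finset.sum_div]
  refine Finset.sum_le_sum fun ℓ _ => ?_
  have h2 := γ.component_sub_le ℓ hn (p₁ := M.pos X₁ j) (hX₀ j) (ht j ℓ).1 (ht j ℓ).2
  have hw : 0 ≤ (γ.component ℓ (orient (M.pos X₁ j)) / γ.density (orient (M.pos X₁ j))) ^ (γ.r - 1) :=
    Real.rpow_nonneg (div_nonneg (γ.component_nonneg ℓ _) (Real.rpow_nonneg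
      (Finset.sum_nonneg fun ℓ _ => Real.rpow_nonneg (γ.component_nonneg ℓ _) _) _)) _
  have h3 := mul_le_mul_of_nonneg_left h2 hw
  rw [component_div_density_unitNormal]
  refine (div_le_div_of_nonneg_right h3 hfac.le).trans (le_of_eq ?_)
  rw [mul_comm (area _), mul_assoc _ (γ.component ℓ (unitNormal _)),
    mul_comm (γ.component ℓ (unitNormal _)), area_mul_component]
  rw [← mul_assoc, mul_div_assoc]
  rfl

end Anisotropy

end Aniso

/-! ### Polyhedral regions of the space and of a hyperplane -/

section Hyperplane

variable {n : ℕ}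

theorem map_cons_cons_comm {E : Type*} [AddCommGroup E] [Module ℝ E] {m : ℕ}
    (D : E [⋀^Fin (m + 2)]→ₗ[ℝ] ℝ) (x y : E) (v : Fin m → E) :
    D (Fin.cons x (Fin.cons y v)) = -D (Fin.cons y (Fin.cons x v)) := by
  have := D.map_swap (Fin.cons y (Fin.cons x v) : Fin (m + 2) → E) (i := 0) (j := 1) (by simp)
  rw [← this]
  congr 1
  ext i
  refine Fin.cases ?_ (fun i => ?_) i
  · simp
  · refine Fin.cases ?_ (fun i => ?_) i
    · simp
    · have h0 : i.succ.succ ≠ (0 : Fin (m + 2)) := Fin.succ_ne_zero _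
      have h1 : i.succ.succ ≠ (1 : Fin (m + 2)) := fun h =>
        Fin.succ_ne_zero i (Fin.succ_injective _ h)
      simp [Function.comp, Equiv.swap_apply_of_ne_of_ne h0 h1]

/-- The volume form of the hyperplanes with the normal `e`, oriented such that
`⟨v 0, e ∧ v 1 ∧ v 2 ∧ …⟩` is its value at `v`. -/
noncomputable def planeForm (e : Pt n) : Pt n [⋀^Fin (n + 1)]→ₗ[ℝ] ℝ :=
  -(stdDet (n + 1)).curryLeft e

theorem planeForm_cons (e x : Pt n) (v : Fin n → Pt n) :
    planeForm e (Fin.cons x v) = inner ℝ x (wedge (Fin.cons e v)) := by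
  rw [inner_wedge, map_cons_cons_comm]
  rfl

theorem continuous_planeForm (e : Pt n) : Continuous (planeForm e) := by
  have : ⇑(planeForm e) = fun v => -stdDet (n + 1) (Fin.cons e v) := rfl
  rw [this]
  refine ((continuous_stdDet (n + 1)).comp (continuous_pi fun i => ?_)).neg
  refine Fin.cases ?_ (fun i => ?_) i
  · exact continuous_const
  · exact continuous_apply i

/-- The volume form of the space, contracted with the unit normal of a hyperplane, is up to sign the
volume form of the hyperplane. -/
theorem abs_stdDet_cons_map {e : Pt n} (he : ‖e‖ = 1)
    (φ : EuclideanSpace ℝ (Fin (n + 1)) →ₗᵢ[ℝ] Pt n) (hφ : ∀ x, inner ℝ e (φ x) = 0)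
    (v : Fin (n + 1) → EuclideanSpace ℝ (Fin (n + 1))) :
    |stdDet (n + 1) (Fin.cons e fun a => φ (v a))| = |stdDet n v| := by
  rw [← sq_eq_sq_iff_abs_eq_abs]
  have hgram : ∀ {k : ℕ} (u : Fin (k + 1) → EuclideanSpace ℝ (Fin (k + 1))),
      stdDet k u ^ 2 = (Matrix.gram ℝ u).det := by
    intro k u
    rw [stdDet_apply, sq]
    nth_rw 2 [← Matrix.det_transpose]
    rw [← Matrix.det_mul]
    congr 1
    ext i j
    rw [Matrix.gram_apply, Matrix.mul_apply, PiLp.inner_apply]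
    refine Finset.sum_congr rfl fun c _ => ?_
    simp [mul_comm]
  rw [hgram, hgram, det_of_first_row]
  · have h0 : Matrix.gram ℝ (Fin.cons e fun a => φ (v a) : Fin (n + 2) → Pt n) 0 0 = 1 := by
      rw [Matrix.gram_apply]; simp [he]
    rw [h0, one_mul]
    congr 1
    ext a b
    simp [Matrix.gram_apply]
  · intro b
    rw [Matrix.gram_apply]
    simp [hφ]

/-- An isometric parameterization of the orthogonal complement of a unit vector. -/
theorem exists_linearIsometry_orthogonal {e : Pt n} (he : ‖e‖ = 1) :
    ∃ φ : EuclideanSpace ℝ (Fin (n + 1)) →ₗᵢ[ℝ] Pt n,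
      (∀ x, inner ℝ e (φ x) = 0) ∧ ∀ y, inner ℝ e y = 0 → ∃ x, φ x = y := by
  have he0 : e ≠ 0 := by rintro rfl; simp at he
  have hfin : Module.finrank ℝ (Submodule.span ℝ {e})ᗮ = n + 1 := by
    have := Submodule.finrank_add_finrank_orthogonal (Submodule.span ℝ {e})
    rw [finrank_span_singleton he0, finrank_euclideanSpace, Fintype.card_fin] at this
    omega
  set b := (stdOrthonormalBasis ℝ (Submodule.span ℝ {e})ᗮ).reindex (finCongr hfin) with hb
  refine ⟨(Submodule.subtypeₗᵢ _).comp b.repr.symm.toLinearIsometry, fun x => ?_, fun y hy => ?_⟩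
  · exact Submodule.mem_orthogonal_singleton_iff_inner_right.1 (b.repr.symm x).2
  · exact ⟨b.repr ⟨y, Submodule.mem_orthogonal_singleton_iff_inner_right.2 hy⟩, by simp⟩

/-- An isometric parameterization of a hyperplane, as a translate of a linear map. -/
theorem exists_hyperplane_chart {e : Pt n} (he : ‖e‖ = 1) (c : ℝ) :
    ∃ φ : EuclideanSpace ℝ (Fin (n + 1)) →ₗᵢ[ℝ] Pt n, (∀ x, inner ℝ e (φ x) = 0) ∧
      Isometry (fun x => c • e + φ x) ∧ Set.range (fun x => c • e + φ x) = hyperplane e c := by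
  obtain ⟨φ, h1, h2⟩ := exists_linearIsometry_orthogonal he
  have hee : inner ℝ e e = (1 : ℝ) := by rw [real_inner_self_eq_norm_sq, he]; norm_num
  refine ⟨φ, h1, ?_, ?_⟩
  · exact Isometry.of_dist_eq fun x y => by rw [dist_add_left, φ.dist_map]
  · ext y
    constructor
    · rintro ⟨x, rfl⟩
      simp only [hyperplane, Set.mem_ofPred_eq]
      rw [inner_add_right, inner_smul_right, h1, hee]
      ring
    · intro hy
      obtain ⟨x, hx⟩ := h2 (y - c • e) (by
        rw [inner_sub_right, inner_smul_right, hee, show inner ℝ e y = c from hy]; ring)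
      exact ⟨x, by simp [hx]⟩

theorem hausdorff_image {ψ : EuclideanSpace ℝ (Fin (n + 1)) → Pt n} (hψ : Isometry ψ)
    (s : Set (EuclideanSpace ℝ (Fin (n + 1)))) :
    Measure.euclideanHausdorffMeasure (n + 1) (ψ '' s) = volume s := by
  rw [hψ.euclideanHausdorffMeasure_image, EuclideanSpace.euclideanHausdorffMeasure_eq_volume]

theorem hausdorff_eq_volume_preimage {ψ : EuclideanSpace ℝ (Fin (n + 1)) → Pt n} (hψ : Isometry ψ)
    {s : Set (Pt n)} (hs : s ⊆ Set.range ψ) :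
    Measure.euclideanHausdorffMeasure (n + 1) s = volume (ψ ⁻¹' s) := by
  rw [← hausdorff_image hψ, Set.image_preimage_eq_of_subset hs]

theorem hausdorff_lt_top_of_isBounded {e : Pt n} (he : ‖e‖ = 1) {c : ℝ} {s : Set (Pt n)}
    (hs : s ⊆ hyperplane e c) (hb : Bornology.IsBounded s) :
    Measure.euclideanHausdorffMeasure (n + 1) s < ⊤ := by
  obtain ⟨φ, -, hψ, hrange⟩ := exists_hyperplane_chart he c
  rw [hausdorff_eq_volume_preimage hψ (hrange ▸ hs)]
  exact (hψ.antilipschitz.isBounded_preimage hb).measure_lt_top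

theorem mem_convexHull_of_chart {m : ℕ} {φ : EuclideanSpace ℝ (Fin (n + 1)) →ₗᵢ[ℝ] Pt n} {o : Pt n}
    (p : Fin m → EuclideanSpace ℝ (Fin (n + 1))) {x : EuclideanSpace ℝ (Fin (n + 1))}
    (hx : o + φ x ∈ convexHull ℝ (Set.range fun a => o + φ (p a))) :
    x ∈ convexHull ℝ (Set.range p) := by
  obtain ⟨w, h0, h1, h2⟩ := exists_weights_of_mem_convexHull hx
  have : x = ∑ a, w a • p a := by
    apply φ.injective
    rw [map_sum]
    simp_rw [smul_add, Finset.sum_add_distrib, ← Finset.sum_smul, h1, one_smul] at h2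
    simpa using h2
  rw [this]
  exact (convex_convexHull ℝ _).sum_mem (fun a _ => h0 a) h1
    fun a _ => subset_convexHull ℝ _ ⟨a, rfl⟩

theorem hausdorff_closedSimplex {e : Pt n} (he : ‖e‖ = 1) {c : ℝ} {p : Fin (n + 1) → Pt n}
    (hp : ∀ a, p a ∈ hyperplane e c) :
    Measure.euclideanHausdorffMeasure (n + 1) (closedSimplex p) = 0 := by
  obtain ⟨φ, -, hψ, hrange⟩ := exists_hyperplane_chart he c
  have hp' : ∀ a, ∃ x, c • e + φ x = p a := fun a => by
    have := hp a
    rwa [← hrange] at this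
  choose p' hp' using hp'
  have hsub : closedSimplex p ⊆ (fun x => c • e + φ x) '' (affineSpan ℝ (Set.range p') : Set _) := by
    intro y hy
    have hconv : Convex ℝ (hyperplane e c) := by
      intro x hx y hy a b _ _ hab
      simp only [hyperplane, Set.mem_ofPred_eq] at *
      rw [inner_add_right, inner_smul_right, inner_smul_right, hx, hy, ← add_mul, hab, one_mul]
    have hyA : y ∈ hyperplane e c := by
      refine convexHull_min ?_ hconv hy
      rintro _ ⟨a, rfl⟩
      exact hp a
    rw [← hrange] at hyA
    obtain ⟨x, rfl⟩ := hyA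
    refine ⟨x, convexHull_subset_affineSpan _ (mem_convexHull_of_chart (φ := φ) (o := c • e) p' ?_), rfl⟩
    simp only [hp']
    exact hy
  refine measure_mono_null hsub ?_
  rw [hausdorff_image hψ]
  refine Measure.addHaar_affineSubspace _ _ fun htop => ?_
  have h1 := finrank_vectorSpan_range_le ℝ p' (n := n) (by simp)
  rw [← direction_affineSpan, htop, AffineSubspace.direction_top, finrank_top,
    finrank_euclideanSpace, Fintype.card_fin] at h1
  omega

theorem isClosed_hyperplane (e : Pt n) (c : ℝ) : IsClosed (hyperplane e c) :=
  isClosed_eq (by fun_prop) continuous_const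

theorem BoundsRegion.measurableSet {m : ℕ} {ι : Type*} {A : Set (Pt n)} {p : ι → Fin m → Pt n}
    {w : ι → Pt n} {R : Set (Pt n)} (h : BoundsRegion A p w R) (hA : MeasurableSet A) :
    MeasurableSet R := by
  obtain ⟨U, hU, rfl⟩ := h.isOpen
  exact hA.inter hU.measurableSet

theorem BoundsRegion.subset {m : ℕ} {ι : Type*} {A : Set (Pt n)} {p : ι → Fin m → Pt n}
    {w : ι → Pt n} {R : Set (Pt n)} (h : BoundsRegion A p w R) : R ⊆ A := by
  obtain ⟨U, hU, rfl⟩ := h.isOpen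
  exact Set.inter_subset_left

theorem BoundsRegion.encloses {ι : Type*} {m : ℕ} {p : ι → Fin m → Pt n}
    {w : ι → Pt n} {R : Set (Pt n)} (h : BoundsRegion Set.univ p w R) : Encloses p w R where
  isOpen := by
    obtain ⟨U, hU, rfl⟩ := h.isOpen
    simpa using hU
  bounded := h.bounded
  boundary := fun x hx => h.boundary ⟨Set.mem_univ x, hx⟩
  outer := fun i x hx => by
    obtain ⟨ε, hε, hout⟩ := h.outer i x hx
    exact ⟨ε, hε, fun y hy => hout y (Set.mem_univ y) hy⟩
  disjoint := h.disjoint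

/-- In an isometric chart of a hyperplane, a region of the hyperplane is enclosed by the simplices in
the chart; the normals are pulled back by the adjoint. -/
theorem BoundsRegion.encloses_chart {ι : Type*} {m : ℕ} {e : Pt n} {c : ℝ}
    {φ : EuclideanSpace ℝ (Fin (n + 1)) →ₗᵢ[ℝ] Pt n} (hψ : Isometry (fun x => c • e + φ x))
    (hrange : Set.range (fun x => c • e + φ x) = hyperplane e c)
    {p : ι → Fin m → EuclideanSpace ℝ (Fin (n + 1))} {w : ι → Pt n} {Q : Set (Pt n)}
    (h : BoundsRegion (hyperplane e c) (fun i a => c • e + φ (p i a)) w Q) :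
    Encloses p (fun i => LinearMap.adjoint φ.toLinearMap (w i)) ((fun x => c • e + φ x) ⁻¹' Q) := by
  have hmem : ∀ x, c • e + φ x ∈ hyperplane e c := fun x => by
    rw [← hrange]; exact ⟨x, rfl⟩
  have hint : ∀ i, ∀ x ∈ simplexInterior (p i),
      c • e + φ x ∈ openSimplex (fun a => c • e + φ (p i a)) := by
    rintro i x ⟨v, h0, h1, rfl⟩
    refine ⟨v, h0, h1, ?_⟩
    simp_rw [smul_add, Finset.sum_add_distrib, ← Finset.sum_smul, h1, one_smul]
    simp
  refine ⟨?_, ?_, ?_, ?_, ?_⟩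
  · obtain ⟨U, hU, rfl⟩ := h.isOpen
    rw [Set.preimage_inter]
    refine IsOpen.inter ?_ (hU.preimage hψ.continuous)
    convert isOpen_univ
    exact Set.eq_univ_of_forall hmem
  · exact hψ.antilipschitz.isBounded_preimage h.bounded
  · rintro x ⟨hx1, hx2⟩
    have hc : c • e + φ x ∈ closure Q :=
      hψ.continuous.closure_preimage_subset Q hx1
    obtain ⟨i, hi⟩ := Set.mem_iUnion.1 (h.boundary ⟨hmem x, hc, hx2⟩)
    exact Set.mem_iUnion.2 ⟨i, mem_convexHull_of_chart (p i) hi⟩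
  · intro i x hx
    obtain ⟨ε, hε, hout⟩ := h.outer i _ (hint i x hx)
    refine ⟨ε, hε, fun y hy => ?_⟩
    have h1 := hout (c • e + φ y) (hmem y) (by rwa [hψ.dist_eq])
    have h2 : inner ℝ (c • e + φ y - (c • e + φ x)) (w i)
        = inner ℝ (y - x) (LinearMap.adjoint φ.toLinearMap (w i)) := by
      rw [LinearMap.adjoint_inner_right, add_sub_add_left_eq_sub, ← map_sub]
      rfl
    rwa [h2] at h1
  · intro i j hij
    refine Set.disjoint_left.2 fun x hxi hxj => ?_
    exact Set.disjoint_left.1 (h.disjoint i j hij) (hint i x hxi) (hint j x hxj)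

/-- The volume of a polyhedral region of the space. -/
theorem BoundsRegion.volume_eq (hn : n ≤ 1) {ι : Type*} [Fintype ι] {p : ι → Fin (n + 2) → Pt n}
    {w : ι → Pt n} {R : Set (Pt n)} (h : BoundsRegion Set.univ p w R) {s : ι → ℤ}
    (hs : ∀ i, s i = 1 ∨ s i = -1) (hw : ∀ i, w i = (s i : ℝ) • orient (p i)) :
    volume.real R = volume.real (corner (n + 1)) * ∑ i, (s i : ℝ) * stdDet (n + 1) (p i) := by
  have hval : ∀ i, inner ℝ (p i 0) (w i) = (s i : ℝ) * stdDet (n + 1) (p i) := by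
    intro i
    rw [hw, inner_smul_right, orient, inner_wedge]
    congr 1
    exact map_cons_zero_edges (by omega) (stdDet (n + 1)) (p i)
  rw [h.encloses.volume_eq]
  · simp_rw [hval]
  · intro i a
    rw [← sub_eq_zero, ← inner_sub_left]
    refine Fin.cases (by simp) (fun b => ?_) a
    rw [hw, inner_smul_right]
    exact mul_eq_zero_of_right _ (inner_wedge_self (edges (p i)) b)
  · intro i
    rw [hval, abs_mul]
    rcases hs i with h | h <;> simp [h]

/-- The area of a polyhedral region of a hyperplane. -/
theorem BoundsRegion.hausdorff_eq (hn : n ≤ 1) {e : Pt n} (he : ‖e‖ = 1) {c : ℝ}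
    {ι : Type*} [Fintype ι] {p : ι → Fin (n + 1) → Pt n}
    {w : ι → Pt n} {Q : Set (Pt n)} (h : BoundsRegion (hyperplane e c) p w Q) {s : ι → ℤ}
    (hs : ∀ i, s i = 1 ∨ s i = -1)
    (hw : ∀ i, w i = (s i : ℝ) • wedge (Fin.cons e (edges (p i)))) :
    (Measure.euclideanHausdorffMeasure (n + 1)).real Q
      = volume.real (corner n) * ∑ i, (s i : ℝ) * planeForm e (fun a => p i a - c • e) := by
  obtain ⟨φ, hφ, hψ, hrange⟩ := exists_hyperplane_chart he c
  have hp' : ∀ i a, ∃ x, c • e + φ x = p i a := fun i a => by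
    have := h.vertex_mem i a
    rwa [← hrange] at this
  choose p' hp' using hp'
  have hp : p = fun i a => c • e + φ (p' i a) := by
    ext i a : 2
    exact (hp' i a).symm
  subst hp
  have henc := h.encloses_chart hψ hrange
  rw [measureReal_def, hausdorff_eq_volume_preimage hψ (hrange ▸ h.subset), ← measureReal_def]
  have hedge : ∀ i (b : Fin n), edges (fun a => c • e + φ (p' i a)) b
      = φ (p' i b.succ) - φ (p' i 0) := fun i b => by
    simp [edges]
  have hval : ∀ i, inner ℝ (p' i 0) (LinearMap.adjoint φ.toLinearMap (w i))
      = (s i : ℝ) * planeForm e (fun a => c • e + φ (p' i a) - c • e) := by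
    intro i
    rw [LinearMap.adjoint_inner_right, hw, inner_smul_right, ← planeForm_cons]
    congr 1
    simp_rw [add_sub_cancel_left]
    rw [← map_cons_zero_edges (by omega) (planeForm e) fun a => φ (p' i a)]
    congr 2
    exact funext fun b => hedge i b
  rw [henc.volume_eq]
  · simp_rw [hval]
  · intro i a
    rw [← sub_eq_zero, ← inner_sub_left, LinearMap.adjoint_inner_right]
    refine Fin.cases (by simp) (fun b => ?_) a
    rw [hw, inner_smul_right]
    refine mul_eq_zero_of_right _ ?_
    have := inner_wedge_self (Fin.cons e (edges fun a => c • e + φ (p' i a))) b.succ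
    rw [Fin.cons_succ, hedge] at this
    simpa using this
  · intro i
    rw [hval, abs_mul]
    have h1 : |(s i : ℝ)| = 1 := by rcases hs i with h | h <;> simp [h]
    rw [h1, one_mul]
    simp_rw [add_sub_cancel_left]
    rw [← abs_stdDet_cons_map he φ hφ]
    exact abs_neg _

end Hyperplane

/-! ### Changes of contact areas and of enclosed volumes -/

section Motion

variable {n : ℕ}

theorem continuous_wedge : Continuous (wedge : (Fin (n + 1) → Pt n) → Pt n) := by
  refine (PiLp.continuous_toLp 2 _).comp (continuous_pi fun a => Continuous.matrix_det ?_)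
  refine continuous_pi fun i => continuous_pi fun j => ?_
  refine Fin.cases ?_ (fun i => ?_) i
  · exact continuous_const
  · simp only [Matrix.of_apply, Fin.cons_succ]
    fun_prop

theorem segMotion_sub_sub {E : Type*} [NormedAddCommGroup E] [NormedSpace ℝ E] (t₀ t₁ : ℝ)
    (x y x' y' o : E) (t : ℝ) :
    segMotion t₀ t₁ (x - o) (y - o) t - segMotion t₀ t₁ (x' - o) (y' - o) t
      = segMotion t₀ t₁ x y t - segMotion t₀ t₁ x' y' t := by
  simp only [segMotion, smul_sub]
  abel

theorem inner_segMotion {e : Pt n} {c : ℝ} {t₀ t₁ : ℝ} (ht : t₀ < t₁) {x y : Pt n}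
    (hx : x ∈ hyperplane e c) (hy : y ∈ hyperplane e c) (t : ℝ) :
    inner ℝ e (segMotion t₀ t₁ x y t) = c := by
  have h0 : t₁ - t₀ ≠ 0 := (sub_pos.2 ht).ne'
  rw [segMotion, inner_add_right, inner_smul_right, inner_smul_right,
    show inner ℝ e x = c from hx, show inner ℝ e y = c from hy]
  field_simp
  ring

/-- The volume form vanishes on vectors of a hyperplane. -/
theorem stdDet_eq_zero_of_orthogonal {e : Pt n} (he : e ≠ 0) {u : Fin (n + 2) → Pt n}
    (hu : ∀ a, inner ℝ e (u a) = 0) : stdDet (n + 1) u = 0 := by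
  rw [stdDet_eq_zero_iff]
  intro htop
  have hle : Submodule.span ℝ (Set.range u) ≤ (Submodule.span ℝ {e})ᗮ := by
    rw [Submodule.span_le]
    rintro _ ⟨a, rfl⟩
    exact Submodule.mem_orthogonal_singleton_iff_inner_right.2 (hu a)
  rw [htop] at hle
  have := Submodule.mem_orthogonal_singleton_iff_inner_right.1 (hle (Submodule.mem_top (x := e)))
  exact he (inner_self_eq_zero.1 this)

/-- The volume form of a hyperplane vanishes on vectors of a `(d-2)`-plane. -/
theorem planeForm_eq_zero_of_orthogonal {e e' : Pt n} (he' : e' ≠ 0) (hee' : inner ℝ e e' = 0)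
    {u : Fin (n + 1) → Pt n} (hu : ∀ a, inner ℝ e (u a) = 0) (hu' : ∀ a, inner ℝ e' (u a) = 0) :
    planeForm e u = 0 := by
  have hval : planeForm e u = -inner ℝ e (wedge u) := by
    rw [inner_wedge]; rfl
  rw [hval, neg_eq_zero]
  by_contra h0
  have hw : wedge u ≠ 0 := fun h => h0 (by rw [h, inner_zero_right])
  set l := inner ℝ e' (wedge u) / inner ℝ e (wedge u) with hl
  obtain ⟨c, hc⟩ := exists_coeff_of_inner_wedge_eq_zero (t := e' - l • e) hw (by
    rw [inner_sub_left, inner_smul_left, hl]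
    simp [div_mul_cancel₀ _ h0])
  have h1 : e' - l • e = 0 := by
    rw [← inner_self_eq_zero (𝕜 := ℝ)]
    conv_lhs => rw [hc]
    rw [sum_inner]
    refine Finset.sum_eq_zero fun b _ => ?_
    rw [inner_smul_left, ← hc, inner_sub_right, inner_smul_right, real_inner_comm, hu',
      real_inner_comm, hu]
    simp
  rw [sub_eq_zero] at h1
  have he : e ≠ 0 := fun h => h0 (by rw [h, inner_zero_left])
  rw [h1, inner_smul_right] at hee'
  rcases mul_eq_zero.1 hee' with h | h
  · exact he' (by rw [h1, h, zero_smul])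
  · exact he (inner_self_eq_zero.1 h)

theorem integral_inner_const {f : ℝ → Pt n} (hf : Continuous f) (δ : Pt n) (t₀ t₁ : ℝ) :
    ∫ t in t₀..t₁, inner ℝ δ (f t) = inner ℝ δ (∫ t in t₀..t₁, f t) :=
  (innerSL ℝ δ).intervalIntegral_comp_comm (hf.intervalIntegrable _ _)

variable {M : Cluster n} {t₀ t₁ : ℝ} {X₀ X₁ : Fin M.nV → Pt n}

theorem continuous_wedge_cons_edges (e : Pt n) (p₀ p₁ : Fin (n + 1) → Pt n) :
    Continuous fun t => wedge (Fin.cons e (edges fun b => segMotion t₀ t₁ (p₀ b) (p₁ b) t)) := by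
  refine continuous_wedge.comp (continuous_pi fun b => ?_)
  refine Fin.cases ?_ (fun b => ?_) b
  · exact continuous_const
  · exact (continuous_segMotion _ _ _ _).sub (continuous_segMotion _ _ _ _)

theorem continuous_orient_segMotion (p₀ p₁ : Fin (n + 2) → Pt n) :
    Continuous fun t => orient fun b => segMotion t₀ t₁ (p₀ b) (p₁ b) t :=
  continuous_wedge.comp (continuous_pi fun _ =>
    (continuous_segMotion _ _ _ _).sub (continuous_segMotion _ _ _ _))

/-- The change of a contact area is the time integral of the flux of the velocity of the boundary
line: the parts of the boundary that stay in fixed `(d-2)`-planes do not contribute. -/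
theorem ContactClosure.hausdorff_sub (hn : n ≤ 1) {nrm : Fin M.nB → Pt n} {off : Fin M.nB → ℝ}
    {k : Fin M.nB} (he : ‖nrm k‖ = 1) (ht : t₀ < t₁) (K : ContactClosure M k)
    {P₀ P₁ : Fin K.nA → Pt n} (hcap : K.CapsFixed nrm X₀ X₁ P₀ P₁) {Q₀ Q₁ : Set (Pt n)}
    (h₀ : K.IsRegion nrm off X₀ P₀ Q₀) (h₁ : K.IsRegion nrm off X₁ P₁ Q₁) :
    (Measure.euclideanHausdorffMeasure (n + 1)).real Q₁
        - (Measure.euclideanHausdorffMeasure (n + 1)).real Q₀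
      = volume.real (corner n) * (1 / (t₁ - t₀) * ∑ F ∈ M.part (M.bdPart k), ∑ b,
          inner ℝ (X₁ (M.facetVertex F b) - X₀ (M.facetVertex F b))
            (∫ t in t₀..t₁, M.xiVec nrm k (M.interp t₀ t₁ X₀ X₁ t) F)) := by
  classical
  set c : {F // F ∈ M.part (M.bdPart k)} ⊕ Fin K.nC → ℤ :=
    Sum.elim (fun F => -(-1 : ℤ) ^ (F.1.2 : ℕ)) K.sign with hc
  set s : {F // F ∈ M.part (M.bdPart k)} ⊕ Fin K.nC → Fin (n + 1) → Fin M.nV ⊕ Fin K.nA :=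
    Sum.elim (fun F b => Sum.inl (M.facetVertex F.1 b)) K.cap with hs
  have hc1 : ∀ i, c i = 1 ∨ c i = -1 := by
    rintro (F | i)
    · rcases neg_one_pow_eq_or ℤ (F.1.2 : ℕ) with h | h
      · right; simp [hc, h]
      · left; simp [hc, h]
    · exact K.sign_eq i
  have harea : ∀ (X : Fin M.nV → Pt n) (P : Fin K.nA → Pt n) (Q : Set (Pt n)),
      K.IsRegion nrm off X P Q → (Measure.euclideanHausdorffMeasure (n + 1)).real Q
        = volume.real (corner n) * ∑ i, (c i : ℝ) *
          planeForm (nrm k) (fun a => Sum.elim X P (s i a) - off k • nrm k) := by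
    intro X P Q hQ
    rw [BoundsRegion.hausdorff_eq hn he hQ hc1]
    · congr 1
      refine Finset.sum_congr rfl fun i _ => ?_
      rcases i with F | i <;> rfl
    · rintro (F | i)
      · simp only [hc, Sum.elim_inl, Cluster.xiVec]
        push_cast
        rfl
      · rfl
  have hcyc : 1 ≤ n → IsCycle c s := K.closed
  have key := IsCycle.sum_sub_eq_integral hcyc (by omega) (planeForm (nrm k))
    (continuous_planeForm (nrm k)) (fun v => Sum.elim X₀ P₀ v - off k • nrm k)
    (fun v => Sum.elim X₁ P₁ v - off k • nrm k) ht
  simp only [segMotion_sub_sub, sub_sub_sub_cancel_right] at key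
  rw [harea X₁ P₁ Q₁ h₁, harea X₀ P₀ Q₀ h₀, ← mul_sub, key, Fintype.sum_sum_type]
  congr 2
  have hcaps : ∑ i : Fin K.nC, (c (Sum.inr i) : ℝ) * ∑ a, ∫ t in t₀..t₁,
      planeForm (nrm k) (Fin.cons (Sum.elim X₁ P₁ (s (Sum.inr i) a)
        - Sum.elim X₀ P₀ (s (Sum.inr i) a)) fun b =>
        segMotion t₀ t₁ (Sum.elim X₀ P₀ (s (Sum.inr i) b.succ)) (Sum.elim X₁ P₁ (s (Sum.inr i) b.succ)) t
          - segMotion t₀ t₁ (Sum.elim X₀ P₀ (s (Sum.inr i) 0)) (Sum.elim X₁ P₁ (s (Sum.inr i) 0)) t)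
      = 0 := by
    refine Finset.sum_eq_zero fun i _ => mul_eq_zero_of_right _ (Finset.sum_eq_zero fun a _ => ?_)
    obtain ⟨e', b', he', hee', hfix⟩ := hcap i
    have hm₀ : ∀ a, Sum.elim X₀ P₀ (K.cap i a) ∈ hyperplane (nrm k) (off k) :=
      fun a => h₀.vertex_mem (Sum.inr i) a
    have hm₁ : ∀ a, Sum.elim X₁ P₁ (K.cap i a) ∈ hyperplane (nrm k) (off k) :=
      fun a => h₁.vertex_mem (Sum.inr i) a
    rw [intervalIntegral.integral_congr (g := fun _ => 0), intervalIntegral.integral_zero]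
    intro t _
    refine planeForm_eq_zero_of_orthogonal he' hee' (fun b => ?_) (fun b => ?_)
    · refine Fin.cases ?_ (fun b => ?_) b
      · rw [Fin.cons_zero, inner_sub_right]
        exact sub_eq_zero.2 ((hm₁ a).trans (hm₀ a).symm)
      · rw [Fin.cons_succ, inner_sub_right]
        exact sub_eq_zero.2 ((inner_segMotion ht (hm₀ _) (hm₁ _) t).trans
          (inner_segMotion ht (hm₀ _) (hm₁ _) t).symm)
    · refine Fin.cases ?_ (fun b => ?_) b
      · rw [Fin.cons_zero, inner_sub_right]
        exact sub_eq_zero.2 ((hfix a).2.trans (hfix a).1.symm)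
      · rw [Fin.cons_succ, inner_sub_right]
        exact sub_eq_zero.2 ((inner_segMotion ht (hfix _).1 (hfix _).2 t).trans
          (inner_segMotion ht (hfix _).1 (hfix _).2 t).symm)
  rw [hcaps, add_zero, ← Finset.sum_coe_sort (M.part (M.bdPart k))]
  refine Finset.sum_congr rfl fun F _ => ?_
  rw [Finset.mul_sum]
  refine Finset.sum_congr rfl fun b _ => ?_
  have hxi : (∫ t in t₀..t₁, M.xiVec nrm k (M.interp t₀ t₁ X₀ X₁ t) F.1)
      = (c (Sum.inl F) : ℝ) • ∫ t in t₀..t₁, wedge (Fin.cons (nrm k) (edges fun b =>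
        segMotion t₀ t₁ (X₀ (M.facetVertex F.1 b)) (X₁ (M.facetVertex F.1 b)) t)) := by
    rw [← intervalIntegral.integral_smul]
    refine intervalIntegral.integral_congr fun t _ => ?_
    simp only [hc, Sum.elim_inl, Cluster.xiVec]
    push_cast
    rfl
  rw [hxi, inner_smul_right, ← integral_inner_const (continuous_wedge_cons_edges _ _ _)]
  congr 1
  refine intervalIntegral.integral_congr fun t _ => ?_
  exact planeForm_cons _ _ _

/-- The change of an enclosed volume is the time integral of the flux of the velocity of the
surfaces of the cluster: the other parts of the boundary move tangentially or do not move. -/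
theorem RegionBoundary.volume_sub (hn : n ≤ 1) {nrm : Fin M.nB → Pt n} {off : Fin M.nB → ℝ}
    (he : ∀ k, nrm k ≠ 0) (ht : t₀ < t₁) (S : RegionBoundary M)
    {P₀ P₁ : Fin S.nA → Pt n} (hcap : S.CapsFixed nrm off X₀ X₁ P₀ P₁) {R₀ R₁ : Set (Pt n)}
    (h₀ : S.IsRegion X₀ P₀ R₀) (h₁ : S.IsRegion X₁ P₁ R₁) :
    volume.real R₁ - volume.real R₀
      = volume.real (corner (n + 1)) * (1 / (t₁ - t₀) *
          ∑ j : {j : Fin M.nJ // M.surf j ∈ S.surfs}, (S.o (M.surf j) : ℝ) * ∑ a,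
            inner ℝ (X₁ (M.simplex j a) - X₀ (M.simplex j a))
              (∫ t in t₀..t₁, orient (M.pos (M.interp t₀ t₁ X₀ X₁ t) j))) := by
  classical
  set c : {j : Fin M.nJ // M.surf j ∈ S.surfs} ⊕ Fin S.nC → ℤ :=
    Sum.elim (fun j => S.o (M.surf j)) (fun _ => 1) with hc
  set s : {j : Fin M.nJ // M.surf j ∈ S.surfs} ⊕ Fin S.nC → Fin (n + 2) → Fin M.nV ⊕ Fin S.nA :=
    Sum.elim (fun j a => Sum.inl (M.simplex j a)) S.cap with hs
  have hc1 : ∀ i, c i = 1 ∨ c i = -1 := by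
    rintro (j | i)
    · exact S.o_eq _
    · exact Or.inl rfl
  have hvol : ∀ (X : Fin M.nV → Pt n) (P : Fin S.nA → Pt n) (R : Set (Pt n)),
      S.IsRegion X P R → volume.real R
        = volume.real (corner (n + 1)) * ∑ i, (c i : ℝ) *
          stdDet (n + 1) (fun a => Sum.elim X P (s i a)) := by
    intro X P R hR
    rw [BoundsRegion.volume_eq hn hR hc1]
    · congr 1
      refine Finset.sum_congr rfl fun i _ => ?_
      rcases i with j | i <;> rfl
    · rintro (j | i)
      · rfl
      · simp [hc]
  have key := IsCycle.sum_sub_eq_integral (fun _ => S.closed) (by omega) (stdDet (n + 1))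
    (continuous_stdDet (n + 1)) (Sum.elim X₀ P₀) (Sum.elim X₁ P₁) ht
  rw [hvol X₁ P₁ R₁ h₁, hvol X₀ P₀ R₀ h₀, ← mul_sub]
  refine congrArg _ (key.trans ?_)
  rw [Fintype.sum_sum_type]
  congr 1
  rw [add_eq_left.2]
  · refine Finset.sum_congr rfl fun j _ => ?_
    congr 1
    refine Finset.sum_congr rfl fun a _ => ?_
    refine Eq.trans ?_ (integral_inner_const (continuous_orient_segMotion
      (fun b => X₀ (M.simplex j b)) (fun b => X₁ (M.simplex j b))) _ t₀ t₁)
    refine intervalIntegral.integral_congr fun t _ => ?_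
    exact (inner_wedge _ _).symm
  · refine Finset.sum_eq_zero fun i _ => mul_eq_zero_of_right _ (Finset.sum_eq_zero fun a _ => ?_)
    rw [intervalIntegral.integral_congr (g := fun _ => 0), intervalIntegral.integral_zero]
    intro t _
    -- on the fixed hypersurface the velocity vanishes, in an external plane it is tangential
    rcases hk : S.capPlane i with _ | k
    · refine (stdDet (n + 1)).map_coord_zero 0 ?_
      rw [Fin.cons_zero]
      exact sub_eq_zero.2 ((hcap i a).2 hk).symm
    · have hm := fun a => (hcap i a).1 k hk
      refine stdDet_eq_zero_of_orthogonal (he k) fun b => ?_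
      refine Fin.cases ?_ (fun b => ?_) b
      · rw [Fin.cons_zero, inner_sub_right]
        exact sub_eq_zero.2 ((hm a).2.trans (hm a).1.symm)
      · rw [Fin.cons_succ, inner_sub_right]
        exact sub_eq_zero.2 ((inner_segMotion ht (hm _).1 (hm _).2 t).trans
          (inner_segMotion ht (hm _).1 (hm _).2 t).symm)

end Motion

/-! ### Energy and volume along one step of the scheme -/

section Step

variable {n : ℕ} {M : Cluster n} {t₀ t₁ : ℝ} {X₀ X₁ : Fin M.nV → Pt n}

/-- The measures of the two parts add up to that of the whole, even though only one of them is known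
to be measurable. -/
theorem Divides.real_add_real {B 𝒢 Gp Gm : Set (Pt n)} (h : Divides B 𝒢 Gp Gm) {μ : Measure (Pt n)}
    (hB : μ B = 0) (h𝒢 : μ 𝒢 ≠ ⊤) (hGm : NullMeasurableSet Gm μ) :
    μ.real Gp + μ.real Gm = μ.real 𝒢 := by
  have hsub : Gp ∪ Gm ⊆ 𝒢 := h.union_eq ▸ Set.subset_union_left
  have hfin : ∀ s ⊆ 𝒢, μ s ≠ ⊤ := fun s hs => ne_top_of_le_ne_top h𝒢 (measure_mono hs)
  have h1 : μ 𝒢 = μ Gp + μ Gm := by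
    rw [← measure_union₀ hGm h.disjoint.aedisjoint]
    refine le_antisymm ?_ (measure_mono hsub)
    rw [← h.union_eq]
    exact (measure_union_le _ _).trans (by rw [hB, add_zero])
  rw [measureReal_def, measureReal_def, measureReal_def, h1, ENNReal.toReal_add
    (hfin _ (Set.subset_union_left.trans hsub)) (hfin _ (Set.subset_union_right.trans hsub))]

theorem hausdorff_boundaryLine {nrm : Fin M.nB → Pt n} {off : Fin M.nB → ℝ} {k : Fin M.nB}
    (he : ‖nrm k‖ = 1) {X : Fin M.nV → Pt n}
    (hX : ∀ v, M.OnPart (M.bdPart k) v → X v ∈ hyperplane (nrm k) (off k)) :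
    Measure.euclideanHausdorffMeasure (n + 1) (M.boundaryLine X k) = 0 := by
  refine (measure_biUnion_null_iff (Finset.countable_toSet _)).2 fun F hF => ?_
  exact hausdorff_closedSimplex he fun b => hX _ ⟨F, hF, b, rfl⟩

/-- The energies of the two parts of an external plane add up to a constant and a multiple of the
area of the polygonal region bounded by the boundary line. -/
theorem contact_eq {e : Pt n} (he : ‖e‖ = 1) {c : ℝ} {D B Gp Gm Q C : Set (Pt n)} {Rad : ℝ}
    (hD : D ⊆ hyperplane e c) (h : Divides B (D ∩ Metric.closedBall 0 Rad) Gp Gm)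
    (hB : Measure.euclideanHausdorffMeasure (n + 1) B = 0) (hQ : MeasurableSet Q)
    (hC : MeasurableSet C) (hdisj : Disjoint Q C)
    (hGm : Gm =ᵐ[Measure.euclideanHausdorffMeasure (n + 1)] (Q ∪ C : Set (Pt n))) (ϱp ϱm : ℝ) :
    ϱp * (Measure.euclideanHausdorffMeasure (n + 1)).real Gp
        + ϱm * (Measure.euclideanHausdorffMeasure (n + 1)).real Gm
      = ϱp * (Measure.euclideanHausdorffMeasure (n + 1)).real (D ∩ Metric.closedBall 0 Rad)
        - (ϱp - ϱm) * ((Measure.euclideanHausdorffMeasure (n + 1)).real Q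
          + (Measure.euclideanHausdorffMeasure (n + 1)).real C) := by
  set μ := (Measure.euclideanHausdorffMeasure (n + 1) : Measure (Pt n)) with hμ
  have hfin : μ (D ∩ Metric.closedBall 0 Rad) ≠ ⊤ :=
    (hausdorff_lt_top_of_isBounded he (Set.inter_subset_left.trans hD)
      (Metric.isBounded_closedBall.subset Set.inter_subset_right)).ne
  have hGmsub : Gm ⊆ D ∩ Metric.closedBall 0 Rad :=
    h.union_eq ▸ Set.subset_union_right.trans Set.subset_union_left
  have hQC : μ (Q ∪ C) ≠ ⊤ := by
    rw [← measure_congr hGm]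
    exact ne_top_of_le_ne_top hfin (measure_mono hGmsub)
  have h1 := h.real_add_real hB hfin
    ((hQ.union hC).nullMeasurableSet.congr hGm.symm)
  have h2 : μ.real Gm = μ.real Q + μ.real C := by
    rw [measureReal_congr hGm]
    exact measureReal_union hdisj hC (ne_top_of_le_ne_top hQC (measure_mono Set.subset_union_left))
      (ne_top_of_le_ne_top hQC (measure_mono Set.subset_union_right))
  rw [← h2, ← h1]
  ring

theorem simplexMeasure_facetPos_ne_zero (F : Fin M.nJ × Fin (n + 2))
    (hX₀ : orient (M.pos X₀ F.1) ≠ 0) : simplexMeasure (M.facetPos X₀ F) ≠ 0 := by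
  have hli : LinearIndependent ℝ (edges (M.facetPos X₀ F)) := by
    have h1 : AffineIndependent ℝ (M.pos X₀ F.1) := by
      rw [affineIndependent_iff_linearIndependent_vsub ℝ _ 0]
      have h2 : LinearIndependent ℝ (edges (M.pos X₀ F.1)) := linearIndependent_of_wedge_ne_zero hX₀
      rw [← linearIndependent_equiv (finSuccAboveEquiv (0 : Fin (n + 2)))]
      exact h2
    have h3 := h1.comp_embedding (Fin.succAboveEmb F.2)
    rw [affineIndependent_iff_linearIndependent_vsub ℝ _ 0,
      ← linearIndependent_equiv (finSuccAboveEquiv (0 : Fin (n + 1)))] at h3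
    exact h3
  have hdet : (Matrix.gram ℝ (edges (M.facetPos X₀ F))).det ≠ 0 :=
    Matrix.det_gram_ne_zero_iff_linearIndependent.2 hli
  have hpos := (Matrix.posSemidef_gram ℝ (edges (M.facetPos X₀ F))).det_nonneg
  rw [simplexMeasure]
  refine div_ne_zero (Real.sqrt_ne_zero'.2 (lt_of_le_of_ne hpos hdet.symm)) ?_
  positivity

/-- At the displacement, the boundary term is the decrease of the contact energy. -/
theorem boundaryTerm_displacement (hn : n ≤ 1) {nrm : Fin M.nB → Pt n} {off : Fin M.nB → ℝ}
    (hnrm : ∀ k, ‖nrm k‖ = 1) (ϱp ϱm : Fin M.nB → ℝ) (ht : t₀ < t₁)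
    (hX₀ : ∀ j, orient (M.pos X₀ j) ≠ 0)
    (hB₀ : ∀ k v, M.OnPart (M.bdPart k) v → X₀ v ∈ hyperplane (nrm k) (off k))
    (hB₁ : ∀ k v, M.OnPart (M.bdPart k) v → X₁ v ∈ hyperplane (nrm k) (off k))
    (𝒢 : ContactParts M nrm off X₀ X₁) :
    M.boundaryTerm nrm (fun k => ϱp k - ϱm k) t₀ t₁ X₀ X₁ (fun v => X₁ v - X₀ v)
      = contactEnergy ϱp ϱm 𝒢.Gp₀ 𝒢.Gm₀ - contactEnergy ϱp ϱm 𝒢.Gp₁ 𝒢.Gm₁ := by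
  rw [contactEnergy, contactEnergy, Cluster.boundaryTerm, ← Finset.sum_sub_distrib]
  refine Finset.sum_congr rfl fun k _ => ?_
  have hplane := (isClosed_hyperplane (nrm k) (off k)).measurableSet
  rw [contact_eq (hnrm k) (𝒢.D_subset k) (𝒢.divides₀ k) (hausdorff_boundaryLine (hnrm k) (hB₀ k))
      ((𝒢.isRegion₀ k).measurableSet hplane) (𝒢.measurableSet_C k) (𝒢.disjoint₀ k) (𝒢.Gm₀_eq k),
    contact_eq (hnrm k) (𝒢.D_subset k) (𝒢.divides₁ k) (hausdorff_boundaryLine (hnrm k) (hB₁ k))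
      ((𝒢.isRegion₁ k).measurableSet hplane) (𝒢.measurableSet_C k) (𝒢.disjoint₁ k) (𝒢.Gm₁_eq k)]
  have harea := (𝒢.K k).hausdorff_sub hn (hnrm k) ht (𝒢.capsFixed k) (𝒢.isRegion₀ k)
    (𝒢.isRegion₁ k)
  -- the volume is `1 / (n + 1)!`, which is the weight of the vertex quadrature only for `n ≤ 1`
  have hcorner : volume.real (corner n) = 1 / ((n : ℝ) + 1) := by
    interval_cases n
    · rw [volume_corner_zero]; norm_num
    · rw [volume_corner_one]; norm_num
  have hterm : ∀ F ∈ M.part (M.bdPart k), simplexMeasure (M.facetPos X₀ F) *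
      (1 / (n + 1) * ∑ b, inner ℝ (M.xiHalf nrm k t₀ t₁ X₀ X₁ F)
        (X₁ (M.facetVertex F b) - X₀ (M.facetVertex F b)))
      = 1 / (n + 1) * (1 / (t₁ - t₀) * ∑ b, inner ℝ
        (X₁ (M.facetVertex F b) - X₀ (M.facetVertex F b))
        (∫ t in t₀..t₁, M.xiVec nrm k (M.interp t₀ t₁ X₀ X₁ t) F)) := by
    intro F _
    have h1 := simplexMeasure_facetPos_ne_zero F (hX₀ F.1)
    have h2 : t₁ - t₀ ≠ 0 := (sub_pos.2 ht).ne'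
    simp_rw [Cluster.xiHalf, inner_smul_left, ← Finset.mul_sum, real_inner_comm]
    simp only [conj_trivial]
    field_simp
  rw [Finset.sum_congr rfl hterm, ← Finset.mul_sum, ← Finset.mul_sum, ← hcorner, ← harea]
  ring

/-- **Energy stability**: testing the velocity equation with the curvature and the curvature
equation with the displacement. -/
theorem IsSolution.energy_le (hn : n ≤ 1) {γ : Anisotropy n} {nrm : Fin M.nB → Pt n}
    {off : Fin M.nB → ℝ} (hnrm : ∀ k, ‖nrm k‖ = 1) {ϱp ϱm : Fin M.nB → ℝ} (ht : t₀ < t₁)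
    (hX₀ : ∀ j, orient (M.pos X₀ j) ≠ 0)
    (hB₀ : ∀ k v, M.OnPart (M.bdPart k) v → X₀ v ∈ hyperplane (nrm k) (off k))
    {frame : Fin M.nJ → Fin γ.L → Fin (n + 1) → Pt n} (hframe : γ.IsFrame M X₀ frame)
    {κ : Fin M.nS → Fin M.nV → ℝ}
    (hsol : IsSolution M γ nrm (fun k => ϱp k - ϱm k) t₀ t₁ X₀ frame X₁ κ)
    (𝒢 : ContactParts M nrm off X₀ X₁) :
    γ.surfaceEnergy M X₁ + contactEnergy ϱp ϱm 𝒢.Gp₁ 𝒢.Gm₁ + (t₁ - t₀) * M.gradForm X₀ κ κ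
      ≤ γ.surfaceEnergy M X₀ + contactEnergy ϱp ϱm 𝒢.Gp₀ 𝒢.Gm₀ := by
  have hB₁ : ∀ k v, M.OnPart (M.bdPart k) v → X₁ v ∈ hyperplane (nrm k) (off k) := by
    intro k v hv
    have h1 := hsol.mem_V k v hv
    have h2 : inner ℝ (nrm k) (X₀ v) = off k := hB₀ k v hv
    rw [inner_sub_right, h2, sub_eq_zero] at h1
    exact h1
  have hform := γ.surfaceEnergy_sub_le_form hn M X₀ X₁ hX₀ frame hframe
  have hbd := boundaryTerm_displacement hn hnrm ϱp ϱm ht hX₀ hB₀ hB₁ 𝒢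
  have hcurv := hsol.curvature_eq _ hsol.mem_V
  have hvel := hsol.velocity_eq κ hsol.mem_W
  have h2 : t₁ - t₀ ≠ 0 := (sub_pos.2 ht).ne'
  set l := M.lumped X₀ (fun j a => inner ℝ (X₁ (M.simplex j a) - X₀ (M.simplex j a))
    (κ (M.surf j) (M.simplex j a) • M.nuHalf t₀ t₁ X₀ X₁ j)) with hl
  have hl' : M.lumped X₀ (fun j a => inner ℝ
      (κ (M.surf j) (M.simplex j a) • M.nuHalf t₀ t₁ X₀ X₁ j)
      (X₁ (M.simplex j a) - X₀ (M.simplex j a))) = l := by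
    simp only [hl, real_inner_comm]
  rw [hl', hbd] at hcurv
  have h3 : (t₁ - t₀) * M.gradForm X₀ κ κ = l := by
    rw [sub_eq_zero] at hvel
    rw [← hvel]
    field_simp
  linarith

/-- The alternating cochain that is dual to an ordered simplex `f`: it is the relative orientation
of `g` and `f` if `g` is an ordering of `f` (for injective `f`), and zero otherwise. -/
noncomputable def dualCochain {V : Type*} {m : ℕ} (f g : Fin m → V) : ℝ := by
  classical
  exact ∑ π : Equiv.Perm (Fin m), if g = f ∘ π then ((Equiv.Perm.sign π : ℤ) : ℝ) else 0

theorem isAlternating_dualCochain {V : Type*} {m : ℕ} (f : Fin m → V) :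
    IsAlternating (dualCochain f) := by
  classical
  intro g τ
  unfold dualCochain
  rw [Finset.mul_sum, ← Equiv.sum_comp (Equiv.mulRight τ)]
  refine Finset.sum_congr rfl fun π _ => ?_
  have hiff : g ∘ τ = f ∘ (Equiv.mulRight τ π) ↔ g = f ∘ π := by
    constructor
    · intro h
      ext x
      have := congrFun h (τ⁻¹ x)
      simpa using this
    · rintro rfl
      rfl
  simp only [hiff]
  split_ifs with h
  · simp [mul_comm]
  · simp

theorem dualCochain_comp {V : Type*} {m : ℕ} {f : Fin m → V} (hf : Function.Injective f)
    (π : Equiv.Perm (Fin m)) : dualCochain f (f ∘ π) = ((Equiv.Perm.sign π : ℤ) : ℝ) := by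
  classical
  unfold dualCochain
  rw [Finset.sum_eq_single π]
  · simp
  · intro τ _ hτ
    rw [if_neg]
    intro h
    apply hτ
    ext x
    rw [hf (congrFun h x)]
  · simp

theorem exists_sameUpTo_of_dualCochain_ne_zero {V : Type*} {m : ℕ} {f g : Fin m → V}
    (h : dualCochain f g ≠ 0) : ∃ ε, SameUpTo f g ε := by
  classical
  unfold dualCochain at h
  obtain ⟨π, -, hπ⟩ := Finset.exists_ne_zero_of_sum_ne_zero h
  refine ⟨_, π, ?_, rfl⟩
  by_contra hne
  exact hπ (if_neg hne)

theorem facetVertex_injective (F : Fin M.nJ × Fin (n + 2)) :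
    Function.Injective (M.facetVertex F) :=
  (M.simplex_injective F.1).comp Fin.succAbove_right_injective

/-- The oriented indicator of the surfaces that bound an enclosed region is an admissible test
function: as the boundary of the region is closed, its oriented facets cancel along every triple
junction line, where only facets of the three surfaces of the cluster meet. -/
theorem RegionBoundary.memW_indicator (S : RegionBoundary M) :
    M.MemW fun i _ => if i ∈ S.surfs then (S.o i : ℝ) else 0 := by
  classical
  rintro k v ⟨F₀, hF₀, -⟩
  choose F hF ε hsame hsign using fun l => M.tj_match k 0 l F₀ hF₀
  choose π hπ hε using hsame
  have hsurf : ∀ l, M.surf (F l).1 = M.partSurf (M.tjPart k l) := fun l =>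
    M.part_surf _ _ (hF l)
  have hFinj : Function.Injective F := by
    intro l l' h
    apply (M.tj_surf k).injective
    change M.partSurf (M.tjPart k l) = M.partSurf (M.tjPart k l')
    rw [← hsurf, ← hsurf, h]
  set f₀ : Fin (n + 1) → Fin M.nV ⊕ Fin S.nA := fun b => Sum.inl (M.facetVertex F₀ b) with hf₀
  have hf₀inj : Function.Injective f₀ := Sum.inl_injective.comp (facetVertex_injective F₀)
  -- the only facets of the cluster that coincide with `F₀` are the three matched ones
  have honly : ∀ (G : Fin M.nJ × Fin (n + 2)) (ε' : ℤ),
      SameUpTo (M.facetVertex F₀) (M.facetVertex G) ε' → ∃ l, G = F l := by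
    intro G ε' hG
    have htrans : ∀ l, ∃ ε'', SameUpTo (M.facetVertex (F l)) (M.facetVertex G) ε'' := by
      intro l
      obtain ⟨τ, hτ, -⟩ := hG
      refine ⟨_, (π l)⁻¹ * τ, ?_, rfl⟩
      rw [hτ]
      have h1 : M.facetVertex (F l) = M.facetVertex F₀ ∘ π l := hπ l
      rw [h1]
      ext x
      simp
    have hpart : ∃ l, M.surf G.1 = M.surf (F l).1 := by
      by_cases hs : M.surf F₀.1 = M.surf G.1
      · exact ⟨0, by rw [hsurf, ← hs, M.part_surf _ _ hF₀]⟩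
      · obtain ⟨k', j, j', hj, hj'⟩ := M.tj_facet F₀ G ε' hs hG
        have hk : k = k' := M.tjPart_injective _ _ _ _ (M.part_disjoint _ _ F₀ hF₀ hj)
        subst hk
        exact ⟨j', by rw [hsurf, M.part_surf _ _ hj']⟩
    obtain ⟨l, hl⟩ := hpart
    obtain ⟨ε'', hε''⟩ := htrans l
    exact ⟨l, M.part_boundary _ _ (hF l) G ε'' hl hε''⟩
  have hcyc := S.closed (dualCochain f₀) (isAlternating_dualCochain f₀)
  rw [Fintype.sum_sum_type] at hcyc
  have hcaps : ∀ (c : Fin S.nC) (a : Fin (n + 2)), dualCochain f₀ (facet (S.cap c) a) = 0 := by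
    intro c a
    by_contra h
    obtain ⟨ε', hε'⟩ := exists_sameUpTo_of_dualCochain_ne_zero h
    exact S.cap_tj c a k 0 F₀ hF₀ ε' hε'
  simp only [Sum.elim_inl, Sum.elim_inr, hcaps, mul_zero, Finset.sum_const_zero, add_zero] at hcyc
  set χ : Fin M.nS → ℝ := fun i => if i ∈ S.surfs then (S.o i : ℝ) else 0 with hχ
  set T : Fin M.nJ × Fin (n + 2) → ℝ := fun G => χ (M.surf G.1) *
    ((-1 : ℝ) ^ (G.2 : ℕ) * dualCochain f₀ fun b => Sum.inl (M.facetVertex G b)) with hT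
  have hsum : ∑ G, T G = 0 := by
    rw [Fintype.sum_prod_type, ← hcyc, ← Finset.sum_subtype
      (Finset.univ.filter fun j => M.surf j ∈ S.surfs) (p := fun j => M.surf j ∈ S.surfs) (by simp)
      (fun j => (S.o (M.surf j) : ℝ) * ∑ a : Fin (n + 2), (-1 : ℝ) ^ (a : ℕ) *
        dualCochain f₀ (facet (fun a => Sum.inl (M.simplex j a)) a)), Finset.sum_filter]
    refine Finset.sum_congr rfl fun j _ => ?_
    simp only [hT, hχ]
    split_ifs
    · rw [Finset.mul_sum]
      rfl
    · simp
  have hsum3 : ∑ l, T (F l) = 0 := by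
    rw [← hsum, ← Finset.sum_image (s := Finset.univ) (f := T) (g := F)
      (fun l _ l' _ h => hFinj h)]
    refine Finset.sum_subset (Finset.subset_univ _) fun G _ hG => ?_
    by_contra h
    have h1 : dualCochain f₀ (fun b => Sum.inl (M.facetVertex G b)) ≠ 0 := fun h0 => h (by
      simp [hT, h0])
    obtain ⟨ε', τ, hτ, -⟩ := exists_sameUpTo_of_dualCochain_ne_zero h1
    obtain ⟨l, rfl⟩ := honly G _ ⟨τ, by
      ext x
      exact congrArg Fin.val (Sum.inl_injective (congrFun hτ x)), rfl⟩
    exact hG (Finset.mem_image_of_mem _ (Finset.mem_univ l))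
  have hval : ∀ l, T (F l) = ((M.tjSign k 0 : ℝ) * (-1) ^ (F₀.2 : ℕ)) *
      ((M.tjSign k l : ℝ) * χ (M.partSurf (M.tjPart k l))) := by
    intro l
    have h1 : (fun b => Sum.inl (M.facetVertex (F l) b)) = f₀ ∘ π l := by
      ext1 x
      exact congrArg Sum.inl (congrFun (hπ l) x)
    have h2 : (M.tjSign k 0 : ℝ) * (-1) ^ (F₀.2 : ℕ)
        = M.tjSign k l * (-1) ^ ((F l).2 : ℕ) * (Equiv.Perm.sign (π l) : ℤ) := by
      rw [← hε]
      exact_mod_cast hsign l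
    have h3 : (M.tjSign k l : ℝ) * M.tjSign k l = 1 := by
      rcases M.tjSign_eq k l with h | h <;> simp [h]
    simp only [hT, h1, dualCochain_comp hf₀inj, hsurf]
    rw [h2]
    linear_combination (-(χ (M.partSurf (M.tjPart k l))) * (-1) ^ ((F l).2 : ℕ) *
      (Equiv.Perm.sign (π l) : ℤ)) * h3
  simp_rw [hval, ← Finset.mul_sum] at hsum3
  refine (mul_eq_zero.1 hsum3).resolve_left (mul_ne_zero ?_ (by simp))
  rcases M.tjSign_eq k 0 with h | h <;> simp [h]

/-- **Volume conservation**: testing the velocity equation with the oriented indicator of the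
surfaces that bound the region. -/
theorem IsSolution.volume_eq (hn : n ≤ 1) {γ : Anisotropy n} {nrm : Fin M.nB → Pt n}
    {off : Fin M.nB → ℝ} (hnrm : ∀ k, ‖nrm k‖ = 1) {ϱ : Fin M.nB → ℝ} (ht : t₀ < t₁)
    (hX₀ : ∀ j, orient (M.pos X₀ j) ≠ 0)
    {frame : Fin M.nJ → Fin γ.L → Fin (n + 1) → Pt n} {κ : Fin M.nS → Fin M.nV → ℝ}
    (hsol : IsSolution M γ nrm ϱ t₀ t₁ X₀ frame X₁ κ) (S : RegionBoundary M)
    {P₀ P₁ : Fin S.nA → Pt n} (hcap : S.CapsFixed nrm off X₀ X₁ P₀ P₁) {R₀ R₁ : Set (Pt n)}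
    (h₀ : S.IsRegion X₀ P₀ R₀) (h₁ : S.IsRegion X₁ P₁ R₁) : volume R₁ = volume R₀ := by
  classical
  have hfin : ∀ {R : Set (Pt n)}, Bornology.IsBounded R → volume R ≠ ⊤ :=
    fun h => h.measure_lt_top.ne
  rw [← ENNReal.toReal_eq_toReal_iff' (hfin h₁.bounded) (hfin h₀.bounded)]
  change volume.real R₁ = volume.real R₀
  rw [← sub_eq_zero, S.volume_sub hn (fun k hk => by simpa [hk] using hnrm k) ht hcap h₀ h₁]
  refine mul_eq_zero_of_right _ (mul_eq_zero_of_right _ ?_)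
  have hvel := hsol.velocity_eq _ S.memW_indicator
  have hgrad : M.gradForm X₀ κ (fun i _ => if i ∈ S.surfs then (S.o i : ℝ) else 0) = 0 := by
    rw [Cluster.gradForm]
    refine Finset.sum_eq_zero fun j _ => mul_eq_zero_of_right _ ?_
    have : surfGrad (M.pos X₀ j) (fun _ => if M.surf j ∈ S.surfs then (S.o (M.surf j) : ℝ) else 0)
        = 0 := by
      simp [surfGrad]
    rw [this, inner_zero_right]
  have hdt : t₁ - t₀ ≠ 0 := (sub_pos.2 ht).ne'
  rw [hgrad, sub_zero, Cluster.lumped] at hvel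
  have hvel' := (mul_eq_zero.1 ((mul_eq_zero.1 hvel).resolve_left (one_div_ne_zero hdt))
    ).resolve_left (by positivity)
  have hterm : ∀ j, area (M.pos X₀ j) * ∑ a, inner ℝ (X₁ (M.simplex j a) - X₀ (M.simplex j a))
      ((if M.surf j ∈ S.surfs then (S.o (M.surf j) : ℝ) else 0) • M.nuHalf t₀ t₁ X₀ X₁ j)
      = 1 / ((t₁ - t₀) * (n + 1).factorial) * if M.surf j ∈ S.surfs then (S.o (M.surf j) : ℝ) *
        ∑ a, inner ℝ (X₁ (M.simplex j a) - X₀ (M.simplex j a))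
          (∫ t in t₀..t₁, orient (M.pos (M.interp t₀ t₁ X₀ X₁ t) j)) else 0 := by
    intro j
    have hA : ‖orient (M.pos X₀ j)‖ ≠ 0 := norm_ne_zero_iff.2 (hX₀ j)
    have hf : ((n + 1).factorial : ℝ) ≠ 0 := by positivity
    simp only [Cluster.nuHalf, inner_smul_right, ← Finset.mul_sum, area]
    split_ifs
    · field_simp
    · simp
  simp only [hterm, ← Finset.mul_sum] at hvel'
  have h3 := (mul_eq_zero.1 hvel').resolve_left
    (one_div_ne_zero (mul_ne_zero hdt (by positivity)))
  rw [← h3, ← Finset.sum_filter, Finset.sum_subtype (p := fun j => M.surf j ∈ S.surfs)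
    (Finset.univ.filter fun j => M.surf j ∈ S.surfs) (by simp)]

end Step

end ClusterFEM

theorem theorem5p1 {n : ℕ} (hn : n ≤ 1) (M : ClusterFEM.Cluster n) (γ : ClusterFEM.Anisotropy n)
    (nrm : Fin M.nB → ClusterFEM.Pt n) (off : Fin M.nB → ℝ) (hnrm : ∀ k, ‖nrm k‖ = 1)
    (ϱp ϱm : Fin M.nB → ℝ) (t₀ t₁ : ℝ) (ht : t₀ < t₁)
    (X₀ : Fin M.nV → ClusterFEM.Pt n)
    (hX₀ : ∀ j, ClusterFEM.orient (M.pos X₀ j) ≠ 0)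
    (hB₀ : ∀ k v, M.OnPart (M.bdPart k) v → X₀ v ∈ ClusterFEM.hyperplane (nrm k) (off k))
    (frame : Fin M.nJ → Fin γ.L → Fin (n + 1) → ClusterFEM.Pt n)
    (hframe : γ.IsFrame M X₀ frame)
    (X₁ : Fin M.nV → ClusterFEM.Pt n) (κ : Fin M.nS → Fin M.nV → ℝ)
    (hsol : ClusterFEM.IsSolution M γ nrm (fun k => ϱp k - ϱm k) t₀ t₁ X₀ frame X₁ κ) :
    (∀ 𝒢 : ClusterFEM.ContactParts M nrm off X₀ X₁,
      γ.surfaceEnergy M X₁ + ClusterFEM.contactEnergy ϱp ϱm 𝒢.Gp₁ 𝒢.Gm₁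
          + (t₁ - t₀) * M.gradForm X₀ κ κ
        ≤ γ.surfaceEnergy M X₀ + ClusterFEM.contactEnergy ϱp ϱm 𝒢.Gp₀ 𝒢.Gm₀) ∧
    (∀ (S : ClusterFEM.RegionBoundary M) (P₀ P₁ : Fin S.nA → ClusterFEM.Pt n)
      (R₀ R₁ : Set (ClusterFEM.Pt n)), S.CapsFixed nrm off X₀ X₁ P₀ P₁ →
      S.IsRegion X₀ P₀ R₀ → S.IsRegion X₁ P₁ R₁ →
      MeasureTheory.volume R₁ = MeasureTheory.volume R₀) := by
  exact ⟨hsol.energy_le hn hnrm ht hX₀ hB₀ hframe,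
    fun S _ _ _ _ hcap h₀ h₁ => hsol.volume_eq hn hnrm ht hX₀ S hcap h₀ h₁⟩
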